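/- **Model.** Fix $Q\ge 1$, $d_0,d_1$, non-empty open sets $\mathcal T_0\subset\mathbb R^{d_0}$, $\mathcal T\subset\mathbb R^{d_1}$ and two families of probability densities on $\mathbb R$ (with respect to Lebesgue measure), $\{g_{0,t}:t\in\mathcal T_0\}$ and $\{g_t:t\in\mathcal T\}$. A parameter is $\theta=(\pi,w,\nu_0,\nu)$ with $\pi_q>0$, $\sum_{q=1}^Q\pi_q=1$, $w=(w_{q,\ell})\in(0,1)^{Q\times Q}$ symmetric, $\nu_0\in\mathcal T_0$, $\nu=(\nu_{q,\ell})\in\mathcal T^{Q\times Q}$ symmetric. For $n$ nodes let $\mathcal A=\{(i,j):1\le i<j\le n\}$. Under $P_\theta$ (the noisy stochastic block model), $Z_1,\dots,Z_n$ are i.i.d. on $\{1,\dots,Q\}$ with distribution $\pi$; given $Z$, the $A_{i,j}$, $(i,j)\in\mathcal A$, are independent Bernoulli$(w_{Z_i,Z_j})$; given $(Z,A)$, the $X_{i,j}$, $(i,j)\in\mathcal A$, are independent with density $g_{0,\nu_0}$ if $A_{i,j}=0$ and $g_{\nu_{Z_i,Z_j}}$ if $A_{i,j}=1$. Only $X$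 is observed. Put $\boldsymbol\pi_0(\theta)=\sum_{q,\ell}\pi_q\pi_\ell(1-w_{q,\ell})$. For a $\{0,1\}^{\mathcal A}$-valued procedure $\varphi$, $$\mathrm{FDR}(\theta,\varphi)=\mathbb E_\theta\left[\frac{\sum_{\mathcal A}(1-A_{i,j})\varphi_{i,j}}{(\sum_{\mathcal A}\varphi_{i,j})\vee 1}\right],\qquad \mathrm{TDR}(\theta,\varphi)=\frac{\mathbb E_\theta[\sum_{\mathcal A}A_{i,j}\varphi_{i,j}]}{\mathbb E_\theta[\sum_{\mathcal A}A_{i,j}]}.$$ **Procedures** (with $0/0=0$). Let $$\boldsymbol\ell(x,q,\ell,\theta)=\frac{(1-w_{q,\ell})g_{0,\nu_0}(x)}{(1-w_{q,\ell})g_{0,\nu_0}(x)+w_{q,\ell}\,g_{\nu_{q,\ell}}(x)},$$ $$\boldsymbol q_\delta(t,q,\ell;\theta',\theta)=\mathbb P_{\theta'}\big(\boldsymbol\ell(X_{i,j},q,\ell,\theta)\le t\mid Z_i=q,Z_j=\ell,A_{i,j}=\delta\big),\qquad \delta\in\{0,1\},$$ $$\mathbf Q_{\theta'}(\theta,t)=\frac{\sum_{q,\ell}\pi'_q\pi'_\ell(1-w'_{q,\ell})\,\boldsymbol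 q_0(t,q,\ell;\theta',\theta)}{\sum_{q,\ell}\pi'_q\pi'_\ell\,[(1-w'_{q,\ell})\,\boldsymbol q_0(t,q,\ell;\theta',\theta)+w'_{q,\ell}\,\boldsymbol q_1(t,q,\ell;\theta',\theta)]}.$$ For a level $\alpha$, the oracle procedure at the true parameter $\theta_0$ is $\varphi^*_{i,j}=\mathbf 1\{\mathbf Q_{\theta_0}(\theta_0,\boldsymbol\ell(X_{i,j},Z_i,Z_j,\theta_0))\le\alpha\}$. Given an estimator $\hat\theta=\hat\theta_n(X)\in\Theta$ and a clustering $\hat Z=\hat Z_n(X)\in\{1,\dots,Q\}^n$, the plug-in procedure is $\varphi^{\mathrm{VEM}}_{i,j}=\mathbf 1\{\mathbf Q_{\hat\theta}(\hat\theta,\boldsymbol\ell(X_{i,j},\hat Z_i,\hat Z_j,\hat\theta))\le\alpha\}$. **Assumptions.** Let $\Theta$ be a set of parameters which is stable under relabelling: $\theta^\sigma\in\Theta$ for every $\theta\in\Theta$ and every permutation $\sigma$ of $\{1,\dots,Q\}$, where $\theta^\sigma=((\pi_{\sigma(q)}),(w_{\sigma(q),\sigma(\ell)}),\nu_0,(\nu_{\sigma(q),\sigma(\ell)}))$.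 1. (Regularity) For all $q,\ell$ and $\delta\in\{0,1\}$: (i) $(t,\theta,\theta_0)\mapsto\boldsymbol q_\delta(t,q,\ell;\theta_0,\theta)$ is continuous on $[0,1]\times\Theta^2$; (ii) there are $t_{1,q,\ell}(\theta)<t_{2,q,\ell}(\theta)$ in $[0,1]$, not depending on $\delta$, such that for all $\theta,\theta_0\in\Theta$ the map $t\mapsto\boldsymbol q_\delta(t,q,\ell;\theta_0,\theta)$ is continuous on $[0,1]$, equal to $0$ on $[0,t_{1,q,\ell}(\theta)]$, strictly increasing on $[t_{1,q,\ell}(\theta),t_{2,q,\ell}(\theta)]$ and equal to $1$ on $[t_{2,q,\ell}(\theta),1]$. 2. (Complexity) There is an integer $K\ge 1$ such that for all $q,\ell$, $t\in[0,1]$ and $\theta\in\Theta$ the set $\{x\in\mathbb R:\boldsymbol\ell(x,q,\ell,\theta)\le t\}$ is a union of $K$ (possibly empty or unbounded) intervals. **Result.** Under these assumptions fix $\theta_0\in\Theta$ (not depending on $n$), let $\alpha_*=\lim_{t\downarrow t_1(\theta_0)}\mathbf Q_{\theta_0}(\theta_0,t)$ with $t_1(\theta_0)=\min_{q,\ell}t_{1,q,\ell}(\theta_0)$,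 and let $\alpha\in(\alpha_*,\boldsymbol\pi_0(\theta_0))$. Let $(\hat\theta_n,\hat Z_n)_n$ be any estimators and clusterings, for example those given by the variational EM (VEM) algorithm, which are consistent up to label switching: for every $\varepsilon>0$, $$\mathbb P_{\theta_0}\Big(\min_\sigma\big\{\|\hat\theta_n^\sigma-\theta_0\|_\infty\vee\max_{i}|\hat Z_{n,i}-\sigma(Z_i)|\big\}>\varepsilon\Big)\longrightarrow 0\qquad(n\to\infty).$$ Then $$\limsup_n\mathrm{FDR}(\theta_0,\varphi^{\mathrm{VEM}})\le\alpha,\qquad \liminf_n\{\mathrm{TDR}(\theta_0,\varphi^{\mathrm{VEM}})-\mathrm{TDR}(\theta_0,\varphi^*)\}\ge 0.$$ -/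

import Mathlib

open MeasureTheory Filter Topology Set

noncomputable section

namespace NSBM

/-- The set `𝒜 = {(i, j) : i < j}` of all possible undirected edges between `n` nodes. -/
abbrev Edge (n : ℕ) := {p : Fin n × Fin n // p.1 < p.2}

/-- Parameters `θ = (π, w, ν₀, ν)`. As a product of finite powers of `ℝ` this type carries
the sup norm `‖·‖_∞` and its topology. -/
abbrev Param (Q d₀ d₁ : ℕ) :=
  (Fin Q → ℝ) × (Fin Q → Fin Q → ℝ) × (Fin d₀ → ℝ) × (Fin Q → Fin Q → Fin d₁ → ℝ)

namespace Param

variable {Q d₀ d₁ : ℕ}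

/-- The group proportions `π`. -/
abbrev prop (θ : Param Q d₀ d₁) : Fin Q → ℝ := θ.1

/-- The connection probabilities `w`. -/
abbrev w (θ : Param Q d₀ d₁) : Fin Q → Fin Q → ℝ := θ.2.1

/-- The null parameter `ν₀`. -/
abbrev nu0 (θ : Param Q d₀ d₁) : Fin d₀ → ℝ := θ.2.2.1

/-- The effect parameters `ν`. -/
abbrev nu (θ : Param Q d₀ d₁) : Fin Q → Fin Q → Fin d₁ → ℝ := θ.2.2.2

/-- The relabelled parameter `θ^σ`. -/
def perm (σ : Equiv.Perm (Fin Q)) (θ : Param Q d₀ d₁) : Param Q d₀ d₁ :=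
  (fun q => θ.prop (σ q), fun q l => θ.w (σ q) (σ l), θ.nu0, fun q l => θ.nu (σ q) (σ l))

/-- `𝛑₀ = ∑_{q,l} π_q π_l (1 - w_{q,l})`, the expected proportion of absent edges. -/
def nullProp (θ : Param Q d₀ d₁) : ℝ :=
  ∑ q, ∑ l, θ.prop q * θ.prop l * (1 - θ.w q l)

/-- The weight of a non-edge (`δ = false`) or an edge (`δ = true`) between groups `q` and `l`:
`1 - w_{q,l}` or `w_{q,l}`. -/
def edgeWeight (θ : Param Q d₀ d₁) (δ : Bool) (q l : Fin Q) : ℝ :=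
  if δ then θ.w q l else 1 - θ.w q l

end Param

/-- `f` is a probability density with respect to the Lebesgue measure on `ℝ`. -/
def IsDensity (f : ℝ → ℝ) : Prop :=
  Measurable f ∧ (∀ x, 0 ≤ f x) ∧ ∫⁻ x, ENNReal.ofReal (f x) = 1

/-- The two parametric density families `{g_{0,t}, t ∈ 𝒯₀}` (null) and `{g_t, t ∈ 𝒯}`
(alternative), with `𝒯₀ ⊆ ℝ^{d₀}` and `𝒯 ⊆ ℝ^{d₁}` non-empty and open. The values of `g₀`, `g`
outside `𝒯₀`, `𝒯` are never used. -/
structure NoiseFamily (d₀ d₁ : ℕ) where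
  T₀ : Set (Fin d₀ → ℝ)
  T : Set (Fin d₁ → ℝ)
  isOpen_T₀ : IsOpen T₀
  isOpen_T : IsOpen T
  nonempty_T₀ : T₀.Nonempty
  nonempty_T : T.Nonempty
  g₀ : (Fin d₀ → ℝ) → ℝ → ℝ
  g : (Fin d₁ → ℝ) → ℝ → ℝ
  isDensity_g₀ : ∀ t ∈ T₀, IsDensity (g₀ t)
  isDensity_g : ∀ t ∈ T, IsDensity (g t)

/-- Realizations `(Z, A, X)`: group memberships, edges (`true` = present), observations. -/
abbrev Sample (n Q : ℕ) := (Fin n → Fin Q) × (Edge n → Bool) × (Edge n → ℝ)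

/-- The `{0,1}`-valued real number attached to a truth value. -/
def toReal (b : Bool) : ℝ := if b then 1 else 0

/-- Distance up to label switching,
`‖(θ', Z') - (θ, Z)‖ = min_σ max(‖θ'^σ - θ‖_∞, ‖Z' - σ(Z)‖_∞)`. -/
def labelDist {n Q d₀ d₁ : ℕ} (θ' : Param Q d₀ d₁) (Z' : Fin n → Fin Q)
    (θ : Param Q d₀ d₁) (Z : Fin n → Fin Q) : ℝ :=
  Finset.univ.inf' ⟨1, Finset.mem_univ 1⟩ fun σ : Equiv.Perm (Fin Q) =>
    max ‖θ'.perm σ - θ‖ ‖fun i : Fin n => (((Z' i : ℕ) : ℝ) - ((σ (Z i) : ℕ) : ℝ))‖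

/-- `S` is a union of `K` (possibly empty, possibly unbounded) real intervals. -/
def IsUnionOfIntervals (K : ℕ) (S : Set ℝ) : Prop :=
  ∃ I : Fin K → Set ℝ, (∀ k, (I k).OrdConnected) ∧ S = ⋃ k, I k

namespace NoiseFamily

variable {d₀ d₁ : ℕ} (M : NoiseFamily d₀ d₁) {Q : ℕ}

/-- The largest parameter set. The condition `π_q < 1` is automatic if `2 ≤ Q`. -/
def fullParams (Q : ℕ) : Set (Param Q d₀ d₁) :=
  {θ | (∀ q, 0 < θ.prop q) ∧ ∑ q, θ.prop q = 1 ∧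
    (∀ q l, θ.w q l ∈ Ioo (0 : ℝ) 1) ∧ (∀ q l, θ.w q l = θ.w l q) ∧
    θ.nu0 ∈ M.T₀ ∧ (∀ q l, θ.nu q l ∈ M.T) ∧ (∀ q l, θ.nu q l = θ.nu l q)}

/-- The conditional law of `X_{i,j}` given `Z_i = q`, `Z_j = l`, `A_{i,j} = δ`. -/
def obsLaw (θ : Param Q d₀ d₁) (δ : Bool) (q l : Fin Q) : Measure ℝ :=
  volume.withDensity fun x =>
    ENNReal.ofReal (if δ then M.g (θ.nu q l) x else M.g₀ θ.nu0 x)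

/-- The law `P_θ` of `(Z, A, X)` in the noisy stochastic block model with `n` nodes:
the `Z_i` are i.i.d. with distribution `π`; given `Z` the `A_{i,j}` are independent
Bernoulli variables with parameters `w_{Z_i,Z_j}`; given `(Z, A)` the `X_{i,j}` are
independent with densities `g_{0,ν₀}` (if `A_{i,j} = 0`) or `g_{ν_{Z_i,Z_j}}` (if
`A_{i,j} = 1`). -/
def law (n : ℕ) (θ : Param Q d₀ d₁) : Measure (Sample n Q) :=
  ∑ z : Fin n → Fin Q, ∑ a : Edge n → Bool,
    ENNReal.ofReal ((∏ i, θ.prop (z i)) *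
        ∏ e : Edge n, θ.edgeWeight (a e) (z e.1.1) (z e.1.2)) •
      (Measure.pi fun e : Edge n => M.obsLaw θ (a e) (z e.1.1) (z e.1.2)).map
        fun x => (z, a, x)

/-- The false discovery rate `FDR(θ, φ)`. -/
def FDR (n : ℕ) (θ : Param Q d₀ d₁) (φ : Sample n Q → Edge n → Bool) : ℝ :=
  ∫ ω, (∑ e, (1 - toReal (ω.2.1 e)) * toReal (φ ω e)) / max (∑ e, toReal (φ ω e)) 1
    ∂(M.law n θ)

/-- The true discovery rate `TDR(θ, φ)`. -/
def TDR (n : ℕ) (θ : Param Q d₀ d₁) (φ : Sample n Q → Edge n → Bool) : ℝ :=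
  (∫ ω, ∑ e, toReal (ω.2.1 e) * toReal (φ ω e) ∂(M.law n θ)) /
    ∫ ω, ∑ e, toReal (ω.2.1 e) ∂(M.law n θ)

/-- The `ℓ`-value functional `ℓ(x, q, l, θ)`. -/
def ell (x : ℝ) (q l : Fin Q) (θ : Param Q d₀ d₁) : ℝ :=
  (1 - θ.w q l) * M.g₀ θ.nu0 x /
    ((1 - θ.w q l) * M.g₀ θ.nu0 x + θ.w q l * M.g (θ.nu q l) x)

/-- The functional `q_δ(t, q, l; θ', θ) = P_{θ'}(ℓ(X_{i,j}, q, l, θ) ≤ t | Z_i = q, Z_j = l,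
A_{i,j} = δ)`. -/
def qFun (δ : Bool) (t : ℝ) (q l : Fin Q) (θ' θ : Param Q d₀ d₁) : ℝ :=
  (M.obsLaw θ' δ q l).real {x | M.ell x q l θ ≤ t}

/-- `Q_{θ'}(θ, t)`, the marginal false discovery rate under `P_{θ'}` of the procedure which
rejects when the `ℓ`-value at `θ` is at most `t` (with `0 / 0 = 0`). -/
def qVal (θ' θ : Param Q d₀ d₁) (t : ℝ) : ℝ :=
  (∑ q, ∑ l, θ'.prop q * θ'.prop l * ((1 - θ'.w q l) * M.qFun false t q l θ' θ)) /
    ∑ q, ∑ l, θ'.prop q * θ'.prop l *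
      ((1 - θ'.w q l) * M.qFun false t q l θ' θ + θ'.w q l * M.qFun true t q l θ' θ)

/-- The procedure `φ_{i,j} = 1{q_{i,j}(X, z; θ) ≤ α}` which thresholds the `q`-values
`q_{i,j}(X, z; θ) = Q_θ(θ, ℓ(X_{i,j}, z_i, z_j, θ))` at level `α`. -/
def qProc {n : ℕ} (α : ℝ) (θ : Param Q d₀ d₁) (z : Fin n → Fin Q) (x : Edge n → ℝ)
    (e : Edge n) : Bool :=
  decide (M.qVal θ θ (M.ell (x e) (z e.1.1) (z e.1.2) θ) ≤ α)

/-- The oracle procedure `φ*`, which uses the true parameter and the true memberships. -/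
def oracleProc {n : ℕ} (α : ℝ) (θ₀ : Param Q d₀ d₁) (ω : Sample n Q) : Edge n → Bool :=
  M.qProc α θ₀ ω.1 ω.2.2

/-- The plug-in procedure `1{q_{i,j}(X, Ẑ; θ̂) ≤ α}`, where the estimator `θ̂` and the clustering
`Ẑ` are computed from `X`. With the output of a VEM algorithm this is `φ^VEM`. -/
def plugInProc {n : ℕ} (α : ℝ) (θhat : (Edge n → ℝ) → Param Q d₀ d₁)
    (Zhat : (Edge n → ℝ) → Fin n → Fin Q) (x : Edge n → ℝ) : Edge n → Bool :=
  M.qProc α (θhat x) (Zhat x) x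

/-- The regularity assumption on the functionals `q_δ` over the parameter set `Θ`, with
thresholds `t_{1,q,l}(θ)` and `t_{2,q,l}(θ)`. -/
structure Regularity (Θ : Set (Param Q d₀ d₁)) (t₁ t₂ : Fin Q → Fin Q → Param Q d₀ d₁ → ℝ) :
    Prop where
  continuousOn : ∀ δ q l,
    ContinuousOn (fun p : ℝ × Param Q d₀ d₁ × Param Q d₀ d₁ => M.qFun δ p.1 q l p.2.2 p.2.1)
      (Icc 0 1 ×ˢ Θ ×ˢ Θ)
  t₁_mem : ∀ q l, ∀ θ ∈ Θ, t₁ q l θ ∈ Icc (0 : ℝ) 1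
  t₂_mem : ∀ q l, ∀ θ ∈ Θ, t₂ q l θ ∈ Icc (0 : ℝ) 1
  t₁_lt_t₂ : ∀ q l, ∀ θ ∈ Θ, t₁ q l θ < t₂ q l θ
  continuousOn_t : ∀ δ q l, ∀ θ ∈ Θ, ∀ θ₀ ∈ Θ,
    ContinuousOn (fun t => M.qFun δ t q l θ₀ θ) (Icc 0 1)
  eq_zero : ∀ δ q l, ∀ θ ∈ Θ, ∀ θ₀ ∈ Θ, ∀ t ∈ Icc 0 (t₁ q l θ), M.qFun δ t q l θ₀ θ = 0
  strictMonoOn : ∀ δ q l, ∀ θ ∈ Θ, ∀ θ₀ ∈ Θ,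
    StrictMonoOn (fun t => M.qFun δ t q l θ₀ θ) (Icc (t₁ q l θ) (t₂ q l θ))
  eq_one : ∀ δ q l, ∀ θ ∈ Θ, ∀ θ₀ ∈ Θ, ∀ t ∈ Icc (t₂ q l θ) 1, M.qFun δ t q l θ₀ θ = 1

/-- The complexity assumption: the rejection regions are unions of `K` intervals. -/
def Complexity (Θ : Set (Param Q d₀ d₁)) (K : ℕ) : Prop :=
  ∀ q l, ∀ t ∈ Icc (0 : ℝ) 1, ∀ θ ∈ Θ, IsUnionOfIntervals K {x | M.ell x q l θ ≤ t}

/-- The critical level `α_*(θ) = lim_{t ↓ t₁(θ)} Q_θ(θ, t)`, where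
`t₁(θ) = min_{q,l} t_{1,q,l}(θ)`. -/
def alphaStar (t₁ : Fin Q → Fin Q → Param Q d₀ d₁ → ℝ) (θ : Param Q d₀ d₁) : ℝ :=
  limUnder (𝓝[>] (⨅ p : Fin Q × Fin Q, t₁ p.1 p.2 θ)) fun t => M.qVal θ θ t

/-- Consistency of an estimator and a clustering, up to label switching. -/
def Consistent (θ₀ : Param Q d₀ d₁) (θhat : ∀ n, (Edge n → ℝ) → Param Q d₀ d₁)
    (Zhat : ∀ n, (Edge n → ℝ) → Fin n → Fin Q) : Prop :=
  ∀ ε : ℝ, 0 < ε → Tendsto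
    (fun n => M.law n θ₀ {ω | ε < labelDist (θhat n ω.2.2) (Zhat n ω.2.2) θ₀ ω.1}) atTop (𝓝 0)

end NoiseFamily


/-! The following facts show that `qVal` is the marginal false discovery rate of the
`ℓ`-value thresholding procedure, whatever the number `n ≥ 2` of nodes. -/

theorem sum_pi_one {ι κ : Type*} [Fintype ι] [DecidableEq ι] [Fintype κ] (W : ι → κ → ℝ)
    (hW : ∀ i, ∑ r, W i r = 1) (i : ι) (h : κ → ℝ) :
    ∑ a : ι → κ, (∏ k, W k (a k)) * h (a i) = ∑ r, W i r * h r := by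
  have h1 : ∀ a : ι → κ, (∏ k, W k (a k)) * h (a i) =
      ∏ k, (W k (a k) * if k = i then h (a k) else 1) := by
    intro a
    rw [Finset.prod_mul_distrib, Finset.prod_ite_eq' Finset.univ i (fun k => h (a k))]
    simp
  simp_rw [h1]
  rw [← Fintype.prod_sum (fun k r => W k r * if k = i then h r else 1)]
  rw [Finset.prod_eq_single i]
  · simp
  · intro b _ hb
    simp [hb, hW]
  · simp

theorem sum_pi_two {ι κ : Type*} [Fintype ι] [DecidableEq ι] [Fintype κ] [DecidableEq κ]
    (p : κ → ℝ) (hp : ∑ r, p r = 1) {i j : ι} (hij : i ≠ j) (h : κ → κ → ℝ) :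
    ∑ z : ι → κ, (∏ k, p (z k)) * h (z i) (z j) = ∑ q, ∑ l, p q * p l * h q l := by
  have h1 : ∀ z : ι → κ, (∏ k, p (z k)) * h (z i) (z j) =
      ∑ q, h q (z j) * ∏ k, (p (z k) * if k = i then (if z k = q then 1 else 0) else 1) := by
    intro z
    simp_rw [Finset.prod_mul_distrib]
    simp_rw [fun q => Finset.prod_ite_eq' Finset.univ i (fun k => if z k = q then (1 : ℝ) else 0)]
    simp [mul_comm]
  simp_rw [h1]
  rw [Finset.sum_comm]
  refine Finset.sum_congr rfl fun q _ => ?_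
  have h2 : ∀ z : ι → κ, h q (z j) *
      ∏ k, (p (z k) * if k = i then (if z k = q then 1 else 0) else 1) =
      ∏ k, (p (z k) * (if k = i then (if z k = q then 1 else 0) else 1) *
        if k = j then h q (z k) else 1) := by
    intro z
    rw [Finset.prod_mul_distrib (g := fun k => if k = j then h q (z k) else 1),
      Finset.prod_ite_eq' Finset.univ j (fun k => h q (z k))]
    simp [mul_comm]
  simp_rw [h2]
  rw [← Fintype.prod_sum (fun k r => p r * (if k = i then (if r = q then 1 else 0) else 1) *
        if k = j then h q r else 1)]
  rw [Finset.prod_eq_mul i j hij]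
  · simp [hij, hij.symm, Finset.mul_sum, mul_assoc]
  · intro c _ hc
    simp [hc.1, hc.2, hp]
  · simp
  · simp

namespace NoiseFamily

variable {d₀ d₁ : ℕ} (M : NoiseFamily d₀ d₁) {Q : ℕ}

theorem isProbabilityMeasure_obsLaw {θ : Param Q d₀ d₁} (hθ : θ ∈ M.fullParams Q)
    (δ : Bool) (q l : Fin Q) : IsProbabilityMeasure (M.obsLaw θ δ q l) := by
  obtain ⟨-, -, -, -, h0, h1, -⟩ := hθ
  constructor
  rw [obsLaw, withDensity_apply _ MeasurableSet.univ, Measure.restrict_univ]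
  cases δ
  · simpa using (M.isDensity_g₀ _ h0).2.2
  · simpa using (M.isDensity_g _ (h1 q l)).2.2

theorem measurable_ell {θ : Param Q d₀ d₁} (hθ : θ ∈ M.fullParams Q) (q l : Fin Q) :
    Measurable fun x => M.ell x q l θ := by
  obtain ⟨-, -, -, -, h0, h1, -⟩ := hθ
  have a := (M.isDensity_g₀ _ h0).1
  have b := (M.isDensity_g _ (h1 q l)).1
  unfold ell
  fun_prop

/-- Expectation under `P_θ` of a bounded function of `(Z_i, Z_j, A_{i,j}, X_{i,j})`. -/
theorem integral_law {n : ℕ} {θ : Param Q d₀ d₁} (hθ : θ ∈ M.fullParams Q)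
    (e : Edge n) (f : Fin Q → Fin Q → Bool → ℝ → ℝ)
    (hf : ∀ q l δ, Measurable (f q l δ)) (hb : ∀ q l δ x, ‖f q l δ x‖ ≤ 1) :
    Integrable (fun ω : Sample n Q => f (ω.1 e.1.1) (ω.1 e.1.2) (ω.2.1 e) (ω.2.2 e))
      (M.law n θ) ∧
    ∫ ω, f (ω.1 e.1.1) (ω.1 e.1.2) (ω.2.1 e) (ω.2.2 e) ∂(M.law n θ) =
      ∑ q, ∑ l, θ.prop q * θ.prop l *
        ∑ δ : Bool, θ.edgeWeight δ q l * ∫ x, f q l δ x ∂(M.obsLaw θ δ q l) := by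
  have hP := fun δ q l => M.isProbabilityMeasure_obsLaw hθ δ q l
  have hm : Measurable fun ω : Sample n Q =>
      f (ω.1 e.1.1) (ω.1 e.1.2) (ω.2.1 e) (ω.2.2 e) := by
    have h : Measurable fun p : (Fin Q × Fin Q × Bool) × ℝ => f p.1.1 p.1.2.1 p.1.2.2 p.2 :=
      measurable_from_prod_countable_right fun p => hf p.1 p.2.1 p.2.2
    exact h.comp (f := fun ω : Sample n Q =>
      ((ω.1 e.1.1, ω.1 e.1.2, ω.2.1 e), ω.2.2 e)) (by fun_prop)
  have hint : ∀ (z : Fin n → Fin Q) (a : Edge n → Bool),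
      Integrable (fun ω : Sample n Q => f (ω.1 e.1.1) (ω.1 e.1.2) (ω.2.1 e) (ω.2.2 e))
        (ENNReal.ofReal ((∏ i, θ.prop (z i)) *
          ∏ e : Edge n, θ.edgeWeight (a e) (z e.1.1) (z e.1.2)) •
      (Measure.pi fun e : Edge n => M.obsLaw θ (a e) (z e.1.1) (z e.1.2)).map
        fun x => ((z, a, x) : Sample n Q)) := by
    intro z a
    have : IsProbabilityMeasure ((Measure.pi fun e : Edge n =>
        M.obsLaw θ (a e) (z e.1.1) (z e.1.2)).map fun x => ((z, a, x) : Sample n Q)) :=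
      Measure.isProbabilityMeasure_map (by fun_prop)
    exact (Integrable.of_bound hm.aestronglyMeasurable 1
      (Filter.Eventually.of_forall fun ω => hb _ _ _ _)).smul_measure ENNReal.ofReal_ne_top
  refine ⟨?_, ?_⟩
  · rw [law]
    exact integrable_finsetSum_measure.2 fun z _ =>
      integrable_finsetSum_measure.2 fun a _ => hint z a
  rw [law, integral_finsetSum_measure
    (fun z _ => integrable_finsetSum_measure.2 fun a _ => hint z a)]
  simp_rw [fun z => integral_finsetSum_measure (fun a (_ : a ∈ Finset.univ) => hint z a)]
  have hW : ∀ δ q l, 0 ≤ θ.edgeWeight δ q l := by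
    intro δ q l
    have := hθ.2.2.1 q l
    cases δ <;> simp [Param.edgeWeight, this.1.le, this.2.le]
  have key : ∀ (z : Fin n → Fin Q) (a : Edge n → Bool),
      ∫ ω, f (ω.1 e.1.1) (ω.1 e.1.2) (ω.2.1 e) (ω.2.2 e)
        ∂(ENNReal.ofReal ((∏ i, θ.prop (z i)) *
          ∏ e : Edge n, θ.edgeWeight (a e) (z e.1.1) (z e.1.2)) •
      (Measure.pi fun e : Edge n => M.obsLaw θ (a e) (z e.1.1) (z e.1.2)).map
        fun x => ((z, a, x) : Sample n Q)) =
      (∏ i, θ.prop (z i)) * ((∏ e : Edge n, θ.edgeWeight (a e) (z e.1.1) (z e.1.2)) *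
        ∫ x, f (z e.1.1) (z e.1.2) (a e) x ∂(M.obsLaw θ (a e) (z e.1.1) (z e.1.2))) := by
    intro z a
    rw [integral_smul_measure, ENNReal.toReal_ofReal (mul_nonneg
      (Finset.prod_nonneg fun i _ => (hθ.1 _).le) (Finset.prod_nonneg fun i _ => hW _ _ _))]
    rw [integral_map (by fun_prop) hm.aestronglyMeasurable, smul_eq_mul, mul_assoc]
    congr 2
    have he := (measurePreserving_eval
        (fun e : Edge n => M.obsLaw θ (a e) (z e.1.1) (z e.1.2)) e).map_eq
    conv_rhs => rw [← he]
    rw [integral_map (measurable_pi_apply e).aemeasurable (hf _ _ _).aestronglyMeasurable]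
  simp_rw [key, ← Finset.mul_sum]
  have hsum : ∀ q l, ∑ δ, θ.edgeWeight δ q l = 1 := by
    intro q l
    simp [Param.edgeWeight]
  have h1 : ∀ z : Fin n → Fin Q,
      ∑ a : Edge n → Bool, (∏ e : Edge n, θ.edgeWeight (a e) (z e.1.1) (z e.1.2)) *
        ∫ x, f (z e.1.1) (z e.1.2) (a e) x ∂(M.obsLaw θ (a e) (z e.1.1) (z e.1.2)) =
      ∑ δ, θ.edgeWeight δ (z e.1.1) (z e.1.2) *
        ∫ x, f (z e.1.1) (z e.1.2) δ x ∂(M.obsLaw θ δ (z e.1.1) (z e.1.2)) := fun z =>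
    sum_pi_one (fun (e : Edge n) δ => θ.edgeWeight δ (z e.1.1) (z e.1.2))
      (fun e => hsum _ _) e
      (fun δ => ∫ x, f (z e.1.1) (z e.1.2) δ x ∂(M.obsLaw θ δ (z e.1.1) (z e.1.2)))
  simp_rw [h1]
  exact sum_pi_two θ.prop hθ.2.1 (ne_of_lt e.2) (fun q l => ∑ δ, θ.edgeWeight δ q l *
        ∫ x, f q l δ x ∂(M.obsLaw θ δ q l))

theorem setOf_ell_integral {θ' θ : Param Q d₀ d₁} (hθ : θ ∈ M.fullParams Q) (t : ℝ)
    (δ : Bool) (q l : Fin Q) :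
    ∫ x, toReal (decide (M.ell x q l θ ≤ t)) ∂(M.obsLaw θ' δ q l) = M.qFun δ t q l θ' θ := by
  have h : (fun x => toReal (decide (M.ell x q l θ ≤ t))) =
      {x | M.ell x q l θ ≤ t}.indicator 1 := by
    ext x
    simp [toReal, Set.indicator_apply]
  rw [h, integral_indicator_one (measurableSet_le (M.measurable_ell hθ q l) measurable_const)]
  rfl

/-- `Q_{θ'}(θ, t)` is the marginal false discovery rate, under `P_{θ'}`, of the procedure
which rejects when the `ℓ`-value at `θ` is at most `t`. -/
theorem qVal_eq {n : ℕ} (hn : 2 ≤ n) {θ' θ : Param Q d₀ d₁} (hθ' : θ' ∈ M.fullParams Q)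
    (hθ : θ ∈ M.fullParams Q) (t : ℝ) :
    M.qVal θ' θ t =
      (∫ ω, ∑ e : Edge n, (1 - toReal (ω.2.1 e)) *
          toReal (decide (M.ell (ω.2.2 e) (ω.1 e.1.1) (ω.1 e.1.2) θ ≤ t)) ∂(M.law n θ')) /
        ∫ ω, ∑ e : Edge n,
          toReal (decide (M.ell (ω.2.2 e) (ω.1 e.1.1) (ω.1 e.1.2) θ ≤ t)) ∂(M.law n θ') := by
  have hmeas : ∀ q l, Measurable fun x => toReal (decide (M.ell x q l θ ≤ t)) := by
    intro q l
    have h := measurableSet_le (M.measurable_ell hθ q l) (measurable_const (a := t))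
    have : (fun x => toReal (decide (M.ell x q l θ ≤ t))) =
      {x | M.ell x q l θ ≤ t}.indicator 1 := by
      ext x
      simp [toReal, Set.indicator_apply]
    rw [this]
    exact measurable_one.indicator h
  have hb : ∀ b, ‖toReal b‖ ≤ 1 := by intro b; cases b <;> simp [toReal]
  have hb' : ∀ b, ‖1 - toReal b‖ ≤ 1 := by intro b; cases b <;> simp [toReal]
  have h0 := fun e : Edge n => M.integral_law hθ' e
    (fun q l δ x => (1 - toReal δ) * toReal (decide (M.ell x q l θ ≤ t)))
    (fun q l δ => (hmeas q l).const_mul _)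
    (fun q l δ x => by
      rw [norm_mul]; exact mul_le_one₀ (hb' _) (norm_nonneg _) (hb _))
  have h1 := fun e : Edge n => M.integral_law hθ' e
    (fun q l _ x => toReal (decide (M.ell x q l θ ≤ t)))
    (fun q l _ => hmeas q l) (fun _ _ _ _ => hb _)
  rw [integral_finsetSum _ fun e _ => (h0 e).1, integral_finsetSum _ fun e _ => (h1 e).1]
  simp_rw [fun e => (h0 e).2, fun e => (h1 e).2, integral_const_mul,
    M.setOf_ell_integral hθ]
  have hc : (Fintype.card (Edge n) : ℝ) ≠ 0 := by
    have : Nonempty (Edge n) := ⟨⟨(⟨0, by omega⟩, ⟨1, by omega⟩), by simp⟩⟩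
    exact_mod_cast Fintype.card_ne_zero
  rw [Finset.sum_const, Finset.sum_const, Finset.card_univ, nsmul_eq_mul, nsmul_eq_mul,
    mul_div_mul_left _ _ hc]
  simp [qVal, Param.edgeWeight, toReal, add_comm]

end NoiseFamily
end NSBM

end

/-! Write `mass δ θ' θ t` for the probability under `θ'` that an edge slot has status `δ` and an
`ℓ`-value, computed at `θ`, of at most `t`. Then `qVal` is a ratio of masses. Since the `ℓ`-value is
the posterior probability of a non-edge, the q-value is nondecreasing in the threshold, and
thresholding q-values at `α` amounts to thresholding `ℓ`-values at some `τ` (`monotone_qVal`,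
`exists_threshold`).

Consistency up to label switching gives, with probability tending to one, a relabelling `θ` of the
estimator that is close to `θ₀` and under which the clustering is exactly `Z`. The q-value procedure
is equivariant under relabelling (`qProc_perm`), so on this event the plug-in thresholds the
`ℓ`-values at `θ` and the true memberships, at a random level `τ`.

Two uniformities allow for this randomness. Empirical masses are close to `mass δ θ₀ θ t` uniformly
in `θ` and `t` (`tendsto_empMass_uniform`): this is a Glivenko–Cantelli argument over unions of `K`
intervals, based on a variance bound in which only edges sharing a node correlate. Masses are also
continuous in the parameters, uniformly in `t` (`exists_mass_close`). Together they bring the false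
discovery proportion below `α + ρ`, provided the selected mass stays away from zero.

Since `α` exceeds the critical level, some level `s` has q-value strictly below `α`, positive mass,
and nearly the oracle's power (`exists_level`). Strictness survives a small perturbation of the
parameter, so `s ≤ τ`; this gives both the lower bound on the selected mass and the power comparison
(`exists_good_event`). Bounded integrands turn these statements into bounds on expectations. -/

noncomputable section

namespace NSBM
namespace NoiseFamily

variable {d₀ d₁ : ℕ} (M : NoiseFamily d₀ d₁) {Q : ℕ}

/-! ### Expectations under the noisy stochastic block model -/

theorem edgeWeight_nonneg {θ : Param Q d₀ d₁} (hθ : θ ∈ M.fullParams Q) (δ : Bool) (q l : Fin Q) :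
    0 ≤ θ.edgeWeight δ q l := by
  have := hθ.2.2.1 q l
  cases δ <;> simp [Param.edgeWeight, this.1.le, this.2.le]

theorem edgeWeight_le_one {θ : Param Q d₀ d₁} (hθ : θ ∈ M.fullParams Q) (δ : Bool) (q l : Fin Q) :
    θ.edgeWeight δ q l ≤ 1 := by
  have := hθ.2.2.1 q l
  cases δ <;> simp [Param.edgeWeight, this.1.le, this.2.le]

theorem prop_le_one {θ : Param Q d₀ d₁} (hθ : θ ∈ M.fullParams Q) (q : Fin Q) :
    θ.prop q ≤ 1 := by
  rw [← hθ.2.1]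
  exact Finset.single_le_sum (f := θ.prop) (fun i _ => (hθ.1 i).le) (Finset.mem_univ q)

/-- The expectation under `P_θ` of a product of functions of the edges is an average over the
memberships of a product over the edges. -/
theorem integral_law_prod {n : ℕ} {θ : Param Q d₀ d₁} (hθ : θ ∈ M.fullParams Q)
    (f : Edge n → Fin Q → Fin Q → Bool → ℝ → ℝ)
    (hf : ∀ e q l δ, Measurable (f e q l δ)) (hb : ∀ e q l δ x, ‖f e q l δ x‖ ≤ 1) :
    Integrable (fun ω : Sample n Q => ∏ e, f e (ω.1 e.1.1) (ω.1 e.1.2) (ω.2.1 e) (ω.2.2 e))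
      (M.law n θ) ∧
    ∫ ω, ∏ e, f e (ω.1 e.1.1) (ω.1 e.1.2) (ω.2.1 e) (ω.2.2 e) ∂(M.law n θ) =
      ∑ z : Fin n → Fin Q, (∏ i, θ.prop (z i)) * ∏ e : Edge n, ∑ δ : Bool,
        θ.edgeWeight δ (z e.1.1) (z e.1.2) *
          ∫ x, f e (z e.1.1) (z e.1.2) δ x ∂(M.obsLaw θ δ (z e.1.1) (z e.1.2)) := by
  have hP := fun δ q l => M.isProbabilityMeasure_obsLaw hθ δ q l
  have hm : Measurable fun ω : Sample n Q =>
      ∏ e, f e (ω.1 e.1.1) (ω.1 e.1.2) (ω.2.1 e) (ω.2.2 e) := by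
    refine Finset.measurable_prod _ fun e _ => ?_
    have h : Measurable fun p : (Fin Q × Fin Q × Bool) × ℝ => f e p.1.1 p.1.2.1 p.1.2.2 p.2 :=
      measurable_from_prod_countable_right fun p => hf e p.1 p.2.1 p.2.2
    exact h.comp (f := fun ω : Sample n Q =>
      ((ω.1 e.1.1, ω.1 e.1.2, ω.2.1 e), ω.2.2 e)) (by fun_prop)
  have hint : ∀ (z : Fin n → Fin Q) (a : Edge n → Bool),
      Integrable (fun ω : Sample n Q => ∏ e, f e (ω.1 e.1.1) (ω.1 e.1.2) (ω.2.1 e) (ω.2.2 e))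
        (ENNReal.ofReal ((∏ i, θ.prop (z i)) *
          ∏ e : Edge n, θ.edgeWeight (a e) (z e.1.1) (z e.1.2)) •
      (Measure.pi fun e : Edge n => M.obsLaw θ (a e) (z e.1.1) (z e.1.2)).map
        fun x => ((z, a, x) : Sample n Q)) := by
    intro z a
    have : IsProbabilityMeasure ((Measure.pi fun e : Edge n =>
        M.obsLaw θ (a e) (z e.1.1) (z e.1.2)).map fun x => ((z, a, x) : Sample n Q)) :=
      Measure.isProbabilityMeasure_map (by fun_prop)
    refine (Integrable.of_bound hm.aestronglyMeasurable 1
      (Filter.Eventually.of_forall fun ω => ?_)).smul_measure ENNReal.ofReal_ne_top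
    rw [norm_prod]
    exact Finset.prod_le_one (fun _ _ => norm_nonneg _) fun _ _ => hb _ _ _ _ _
  refine ⟨?_, ?_⟩
  · rw [law]
    exact integrable_finsetSum_measure.2 fun z _ =>
      integrable_finsetSum_measure.2 fun a _ => hint z a
  rw [law, integral_finsetSum_measure
    (fun z _ => integrable_finsetSum_measure.2 fun a _ => hint z a)]
  simp_rw [fun z => integral_finsetSum_measure (fun a (_ : a ∈ Finset.univ) => hint z a)]
  refine Finset.sum_congr rfl fun z _ => ?_
  -- Distributing the product over edges across the sums over `δ` produces one term per adjacency
  -- configuration, which matches the sum defining `law` term by term.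
  rw [Fintype.prod_sum, Finset.mul_sum]
  refine Finset.sum_congr rfl fun a _ => ?_
  rw [integral_smul_measure, ENNReal.toReal_ofReal (mul_nonneg
      (Finset.prod_nonneg fun i _ => (hθ.1 _).le)
      (Finset.prod_nonneg fun i _ => M.edgeWeight_nonneg hθ _ _ _)),
    integral_map (by fun_prop) hm.aestronglyMeasurable, smul_eq_mul, mul_assoc,
    Finset.prod_mul_distrib]
  congr 2
  exact integral_fintype_prod_eq_prod (fun e x => f e (z e.1.1) (z e.1.2) (a e) x)

theorem sum_prod_prop {n : ℕ} {θ : Param Q d₀ d₁} (hθ : θ ∈ M.fullParams Q) :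
    ∑ z : Fin n → Fin Q, ∏ i, θ.prop (z i) = 1 := by
  rw [← Fintype.prod_sum (fun (_ : Fin n) r => θ.prop r)]
  simp [hθ.2.1]

theorem isProbabilityMeasure_law (n : ℕ) {θ : Param Q d₀ d₁} (hθ : θ ∈ M.fullParams Q) :
    IsProbabilityMeasure (M.law n θ) := by
  have hP := fun δ q l => M.isProbabilityMeasure_obsLaw hθ δ q l
  have h := (M.integral_law_prod (n := n) hθ (fun _ _ _ _ _ => 1)
    (fun _ _ _ _ => measurable_const) (by simp))
  simp only [Finset.prod_const_one, integral_const, probReal_univ, smul_eq_mul, mul_one] at h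
  have h2 : ∀ q l, ∑ δ, θ.edgeWeight δ q l = 1 := by simp [Param.edgeWeight]
  simp only [h2, Finset.prod_const_one, mul_one, M.sum_prod_prop hθ] at h
  have hfin : IsFiniteMeasure (M.law n θ) :=
    (integrable_const_iff_isFiniteMeasure (one_ne_zero (α := ℝ))).1 h.1
  constructor
  rw [← ENNReal.toReal_eq_one_iff]
  exact h.2

/-! ### Cell frequencies: second moments and the law of large numbers for one cell -/

/-- The frequency of the edges between groups `q` and `l` with status `δ` and observation in
`B`. -/
def freq {n : ℕ} (δ : Bool) (q l : Fin Q) (B : Set ℝ) (ω : Sample n Q) : ℝ :=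
  open Classical in
  (∑ e : Edge n, if (ω.1 e.1.1 = q ∧ ω.1 e.1.2 = l ∧ ω.2.1 e = δ) ∧ ω.2.2 e ∈ B then 1 else 0) /
    Fintype.card (Edge n)

/-- The probability that an edge is between groups `q` and `l`, has status `δ` and
observation in `B`. -/
def cellProb (θ : Param Q d₀ d₁) (δ : Bool) (q l : Fin Q) (B : Set ℝ) : ℝ :=
  θ.prop q * θ.prop l * (θ.edgeWeight δ q l * (M.obsLaw θ δ q l).real B)

section
open Classical

/-- The indicator that an edge is between groups `q` and `l`, has status `δ` and observation
in `B`, as a function of its characteristics. -/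
def cellInd (δ : Bool) (q l : Fin Q) (B : Set ℝ) (q' l' : Fin Q) (δ' : Bool) (x : ℝ) : ℝ :=
  if (q' = q ∧ l' = l ∧ δ' = δ) ∧ x ∈ B then 1 else 0

theorem measurable_cellInd (δ : Bool) (q l : Fin Q) {B : Set ℝ} (hB : MeasurableSet B)
    (q' l' : Fin Q) (δ' : Bool) : Measurable (cellInd δ q l B q' l' δ') :=
  Measurable.ite (by
    by_cases h : q' = q ∧ l' = l ∧ δ' = δ
    · simpa [h] using hB
    · simp [h]) measurable_const measurable_const

theorem cellInd_nonneg (δ : Bool) (q l : Fin Q) (B : Set ℝ)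
    (q' l' : Fin Q) (δ' : Bool) (x : ℝ) : 0 ≤ cellInd δ q l B q' l' δ' x := by
  unfold cellInd; split_ifs <;> simp

theorem cellInd_le_one (δ : Bool) (q l : Fin Q) (B : Set ℝ)
    (q' l' : Fin Q) (δ' : Bool) (x : ℝ) : cellInd δ q l B q' l' δ' x ≤ 1 := by
  unfold cellInd; split_ifs <;> simp

theorem norm_cellInd_le_one (δ : Bool) (q l : Fin Q) (B : Set ℝ)
    (q' l' : Fin Q) (δ' : Bool) (x : ℝ) : ‖cellInd δ q l B q' l' δ' x‖ ≤ 1 := by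
  rw [Real.norm_of_nonneg (cellInd_nonneg ..)]; exact cellInd_le_one ..

/-- This is the factor of one edge in `integral_law_prod`. The membership condition is split into
one indicator per endpoint so that the sum over memberships can factor over the nodes. -/
theorem sum_integral_cellInd {θ : Param Q d₀ d₁} (δ : Bool) (q l : Fin Q) {B : Set ℝ}
    (hB : MeasurableSet B) (q' l' : Fin Q) :
    ∑ δ', θ.edgeWeight δ' q' l' * ∫ x, cellInd δ q l B q' l' δ' x ∂(M.obsLaw θ δ' q' l') =
      (if q' = q then 1 else 0) * (if l' = l then 1 else 0) *
        (θ.edgeWeight δ q l * (M.obsLaw θ δ q l).real B) := by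
  rw [Finset.sum_eq_single δ]
  · by_cases h : q' = q ∧ l' = l
    · obtain ⟨rfl, rfl⟩ := h
      have : cellInd δ q' l' B q' l' δ = B.indicator 1 := by
        ext x; simp [cellInd, indicator_apply]
      rw [this, integral_indicator_one hB]
      simp
    · have : cellInd δ q l B q' l' δ = 0 := by
        ext x; simp only [cellInd, Pi.zero_apply, ite_eq_right_iff]; tauto
      rw [this]
      rw [not_and_or] at h
      rcases h with h | h <;> simp [h]
  · intro δ' _ h
    have : cellInd δ q l B q' l' δ' = 0 := by ext x; simp [cellInd, h]
    simp [this]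
  · simp

variable {n : ℕ} {θ : Param Q d₀ d₁}

theorem integral_cellInd (hθ : θ ∈ M.fullParams Q) (δ : Bool) (q l : Fin Q) {B : Set ℝ}
    (hB : MeasurableSet B) (e : Edge n) :
    Integrable (fun ω : Sample n Q =>
      cellInd δ q l B (ω.1 e.1.1) (ω.1 e.1.2) (ω.2.1 e) (ω.2.2 e)) (M.law n θ) ∧
    ∫ ω, cellInd δ q l B (ω.1 e.1.1) (ω.1 e.1.2) (ω.2.1 e) (ω.2.2 e) ∂(M.law n θ) =
      M.cellProb θ δ q l B := by
  have h := M.integral_law hθ e (cellInd δ q l B) (fun _ _ _ => measurable_cellInd δ q l hB _ _ _)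
    (norm_cellInd_le_one δ q l B)
  refine ⟨h.1, ?_⟩
  rw [h.2]
  simp_rw [M.sum_integral_cellInd δ q l hB]
  simp [cellProb, mul_assoc]

/-- Memberships of four distinct nodes are independent. Each indicator is spread into a product over
all nodes, equal to 1 off its own node, so that the whole sum factors node by node; uninvolved nodes
contribute the total mass of `π`. -/
theorem sum_prop_ite_four (hθ : θ ∈ M.fullParams Q) (q l : Fin Q) {i j i' j' : Fin n}
    (h1 : i ≠ j) (h2 : i' ≠ j') (h3 : i ≠ i') (h4 : i ≠ j') (h5 : j ≠ i') (h6 : j ≠ j') :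
    ∑ z : Fin n → Fin Q, (∏ k, θ.prop (z k)) *
      (((if z i = q then (1 : ℝ) else 0) * if z j = l then 1 else 0) *
        ((if z i' = q then 1 else 0) * if z j' = l then 1 else 0)) =
      (θ.prop q * θ.prop l) ^ 2 := by
  have key : ∀ z : Fin n → Fin Q, (∏ k, θ.prop (z k)) *
      (((if z i = q then (1 : ℝ) else 0) * if z j = l then 1 else 0) *
        ((if z i' = q then 1 else 0) * if z j' = l then 1 else 0)) =
      ∏ k, (θ.prop (z k) * (((if k = i then if z k = q then (1 : ℝ) else 0 else 1) *
        if k = j then if z k = l then 1 else 0 else 1) *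
        ((if k = i' then if z k = q then 1 else 0 else 1) *
          if k = j' then if z k = l then 1 else 0 else 1))) := by
    intro z
    simp only [Finset.prod_mul_distrib]
    rw [Finset.prod_ite_eq' Finset.univ i (fun k => if z k = q then (1 : ℝ) else 0),
      Finset.prod_ite_eq' Finset.univ j (fun k => if z k = l then (1 : ℝ) else 0),
      Finset.prod_ite_eq' Finset.univ i' (fun k => if z k = q then (1 : ℝ) else 0),
      Finset.prod_ite_eq' Finset.univ j' (fun k => if z k = l then (1 : ℝ) else 0)]
    simp only [Finset.mem_univ, if_true]
  simp_rw [key]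
  rw [← Fintype.prod_sum (fun k r =>
      θ.prop r * (((if k = i then if r = q then (1 : ℝ) else 0 else 1) *
        if k = j then if r = l then 1 else 0 else 1) *
        ((if k = i' then if r = q then 1 else 0 else 1) *
          if k = j' then if r = l then 1 else 0 else 1)))]
  have key2 : ∀ k, ∑ r, θ.prop r * (((if k = i then if r = q then (1 : ℝ) else 0 else 1) *
        if k = j then if r = l then 1 else 0 else 1) *
        ((if k = i' then if r = q then 1 else 0 else 1) *
          if k = j' then if r = l then 1 else 0 else 1)) =
      ((if k = i then θ.prop q else 1) * (if k = j then θ.prop l else 1)) *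
        ((if k = i' then θ.prop q else 1) * (if k = j' then θ.prop l else 1)) := by
    intro k
    by_cases hi : k = i
    · subst hi; simp [h1, h3, h4]
    by_cases hj : k = j
    · subst hj; simp [hi, h5, h6]
    by_cases hi' : k = i'
    · subst hi'; simp [hi, hj, h2]
    by_cases hj' : k = j'
    · subst hj'; simp [hi, hj, hi']
    simp [hi, hj, hi', hj', hθ.2.1]
  simp_rw [key2, Finset.prod_mul_distrib]
  rw [Finset.prod_ite_eq', Finset.prod_ite_eq', Finset.prod_ite_eq', Finset.prod_ite_eq']
  simp only [Finset.mem_univ, if_true]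
  ring

/-- Edges without a common node are uncorrelated: the product formula is applied with the function 1
on every other edge. -/
theorem integral_cellInd_mul (hθ : θ ∈ M.fullParams Q) (δ : Bool) (q l : Fin Q) {B : Set ℝ}
    (hB : MeasurableSet B) {e e' : Edge n} (h3 : e.1.1 ≠ e'.1.1) (h4 : e.1.1 ≠ e'.1.2)
    (h5 : e.1.2 ≠ e'.1.1) (h6 : e.1.2 ≠ e'.1.2) :
    ∫ ω, cellInd δ q l B (ω.1 e.1.1) (ω.1 e.1.2) (ω.2.1 e) (ω.2.2 e) *
        cellInd δ q l B (ω.1 e'.1.1) (ω.1 e'.1.2) (ω.2.1 e') (ω.2.2 e') ∂(M.law n θ) =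
      M.cellProb θ δ q l B ^ 2 := by
  have hP := fun δ q l => M.isProbabilityMeasure_obsLaw hθ δ q l
  have hne : e ≠ e' := by rintro rfl; exact h3 rfl
  have h := (M.integral_law_prod (n := n) hθ
    (fun k => if k = e ∨ k = e' then cellInd δ q l B else fun _ _ _ _ => 1)
    (fun k q' l' δ' => by
      split_ifs
      · exact measurable_cellInd δ q l hB _ _ _
      · exact measurable_const)
    (fun k q' l' δ' x => by
      split_ifs
      · exact norm_cellInd_le_one ..
      · simp)).2
  have hpr : ∀ G : Edge n → ℝ, (∀ k, k ≠ e → k ≠ e' → G k = 1) → ∏ k, G k = G e * G e' := by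
    intro G hG
    exact Finset.prod_eq_mul e e' hne (fun k _ hk => hG k hk.1 hk.2) (by simp) (by simp)
  have hW : ∀ q l, ∑ δ, θ.edgeWeight δ q l = 1 := by simp [Param.edgeWeight]
  have hl : ∀ ω : Sample n Q, ∏ k, (if k = e ∨ k = e' then cellInd δ q l B else fun _ _ _ _ => 1)
      (ω.1 k.1.1) (ω.1 k.1.2) (ω.2.1 k) (ω.2.2 k) =
      cellInd δ q l B (ω.1 e.1.1) (ω.1 e.1.2) (ω.2.1 e) (ω.2.2 e) *
        cellInd δ q l B (ω.1 e'.1.1) (ω.1 e'.1.2) (ω.2.1 e') (ω.2.2 e') := by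
    intro ω
    rw [hpr _ (fun k h1 h2 => by simp [h1, h2])]
    simp
  simp only [hl] at h
  rw [h]
  have hr : ∀ z : Fin n → Fin Q, ∏ k : Edge n, ∑ δ', θ.edgeWeight δ' (z k.1.1) (z k.1.2) *
      ∫ x, (if k = e ∨ k = e' then cellInd δ q l B else fun _ _ _ _ => 1)
        (z k.1.1) (z k.1.2) δ' x ∂(M.obsLaw θ δ' (z k.1.1) (z k.1.2)) =
      (((if z e.1.1 = q then (1 : ℝ) else 0) * if z e.1.2 = l then 1 else 0) *
        ((if z e'.1.1 = q then 1 else 0) * if z e'.1.2 = l then 1 else 0)) *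
        (θ.edgeWeight δ q l * (M.obsLaw θ δ q l).real B) ^ 2 := by
    intro z
    rw [hpr _ (fun k h1 h2 => by simpa [h1, h2] using hW _ _)]
    simp only [true_or, or_true, if_true]
    rw [M.sum_integral_cellInd δ q l hB, M.sum_integral_cellInd δ q l hB]
    ring
  simp_rw [hr, ← mul_assoc, ← Finset.sum_mul]
  have := M.sum_prop_ite_four hθ q l e.2.ne e'.2.ne h3 h4 h5 h6
  simp_rw [← mul_assoc] at this
  rw [this, cellProb]
  ring

theorem cellProb_mem (hθ : θ ∈ M.fullParams Q) (δ : Bool) (q l : Fin Q) (B : Set ℝ) :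
    0 ≤ M.cellProb θ δ q l B ∧ M.cellProb θ δ q l B ≤ 1 := by
  have hP := fun δ q l => M.isProbabilityMeasure_obsLaw hθ δ q l
  have h1 := (hθ.1 q).le
  have h2 := (hθ.1 l).le
  have h3 := M.edgeWeight_nonneg hθ δ q l
  refine ⟨by unfold cellProb; positivity, ?_⟩
  unfold cellProb
  exact mul_le_one₀ (mul_le_one₀ (M.prop_le_one hθ q) h2 (M.prop_le_one hθ l)) (by positivity)
    (mul_le_one₀ (M.edgeWeight_le_one hθ δ q l) (by positivity) measureReal_le_one)

/-- Serves to count the edges sharing a node with a given one: the other endpoint determines the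
edge. -/
theorem card_edge_fst (i : Fin n) : (Finset.univ.filter fun e : Edge n => i = e.1.1).card ≤ n := by
  calc _ ≤ (Finset.univ : Finset (Fin n)).card := by
        refine Finset.card_le_card_of_injOn (fun e => e.1.2) (by simp) ?_
        intro e he e' he' h
        simp only [Finset.coe_filter, Finset.mem_univ, true_and, mem_ofPred_eq] at he he'
        exact Subtype.ext (Prod.ext (he ▸ he') h)
    _ = n := by simp

theorem card_edge_snd (i : Fin n) : (Finset.univ.filter fun e : Edge n => i = e.1.2).card ≤ n := by
  calc _ ≤ (Finset.univ : Finset (Fin n)).card := by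
        refine Finset.card_le_card_of_injOn (fun e => e.1.1) (by simp) ?_
        intro e he e' he' h
        simp only [Finset.coe_filter, Finset.mem_univ, true_and, mem_ofPred_eq] at he he'
        exact Subtype.ext (Prod.ext h (he ▸ he'))
    _ = n := by simp

theorem card_edge (n : ℕ) : 2 * Fintype.card (Edge n) + n = n * n := by
  have h1 : Fintype.card (Edge n) =
      (Finset.univ.filter fun p : Fin n × Fin n => p.1 < p.2).card := Fintype.card_subtype _
  have h2 : (Finset.univ.filter fun p : Fin n × Fin n => p.2 < p.1).card =
      (Finset.univ.filter fun p : Fin n × Fin n => p.1 < p.2).card := by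
    refine Finset.card_bij (fun p _ => p.swap) (by simp) (by simp) ?_
    intro b hb
    exact ⟨b.swap, by simpa using hb, by simp⟩
  have h3 : (Finset.univ.filter fun p : Fin n × Fin n => p.1 = p.2).card = n := by
    have : (Finset.univ.filter fun p : Fin n × Fin n => p.1 = p.2) =
        Finset.univ.image fun i : Fin n => (i, i) := by
      ext ⟨a, b⟩; simp
    rw [this, Finset.card_image_of_injective _ (fun a b h => (Prod.ext_iff.1 h).1)]
    simp
  have h4 : (Finset.univ : Finset (Fin n × Fin n)).card = n * n := by simp
  have h5 : (Finset.univ : Finset (Fin n × Fin n)) =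
      ((Finset.univ.filter fun p : Fin n × Fin n => p.1 < p.2) ∪
        (Finset.univ.filter fun p : Fin n × Fin n => p.2 < p.1)) ∪
        (Finset.univ.filter fun p : Fin n × Fin n => p.1 = p.2) := by
    ext p; simp only [Finset.mem_univ, Finset.mem_union, Finset.mem_filter, true_and, true_iff]
    rcases lt_trichotomy p.1 p.2 with h | h | h <;> simp [h]
  rw [h5, Finset.card_union_of_disjoint, Finset.card_union_of_disjoint, h2, h3] at h4
  · omega
  · rw [Finset.disjoint_left]; intro p; simp; intro h; exact h.le
  · rw [Finset.disjoint_left]; intro p; simp only [Finset.mem_union, Finset.mem_filter,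
      Finset.mem_univ, true_and]
    rintro (h | h) h'
    · exact h.ne h'
    · exact h.ne h'.symm

/-- The square is expanded into covariances. They vanish for disjoint edges and are at most 1
otherwise, and each edge meets at most `4 * n` edges, so the variance is of lower order than the
squared number of edges. -/
theorem integral_sq_le (hθ : θ ∈ M.fullParams Q) (δ : Bool) (q l : Fin Q) {B : Set ℝ}
    (hB : MeasurableSet B) :
    Integrable (fun ω : Sample n Q => (∑ e : Edge n,
      (cellInd δ q l B (ω.1 e.1.1) (ω.1 e.1.2) (ω.2.1 e) (ω.2.2 e) -
        M.cellProb θ δ q l B)) ^ 2) (M.law n θ) ∧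
    ∫ ω : Sample n Q, (∑ e : Edge n,
      (cellInd δ q l B (ω.1 e.1.1) (ω.1 e.1.2) (ω.2.1 e) (ω.2.2 e) -
        M.cellProb θ δ q l B)) ^ 2 ∂(M.law n θ) ≤ 4 * n * Fintype.card (Edge n) := by
  have hL := M.isProbabilityMeasure_law n hθ
  set p := M.cellProb θ δ q l B with hp
  set F : Edge n → Sample n Q → ℝ := fun e ω =>
    cellInd δ q l B (ω.1 e.1.1) (ω.1 e.1.2) (ω.2.1 e) (ω.2.2 e) with hF
  have hI : ∀ e, Integrable (F e) (M.law n θ) := fun e => (M.integral_cellInd hθ δ q l hB e).1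
  have hE : ∀ e, ∫ ω, F e ω ∂(M.law n θ) = p := fun e => (M.integral_cellInd hθ δ q l hB e).2
  have hF0 : ∀ e ω, 0 ≤ F e ω := fun e ω => cellInd_nonneg ..
  have hF1 : ∀ e ω, F e ω ≤ 1 := fun e ω => cellInd_le_one ..
  obtain ⟨hp0, hp1⟩ := M.cellProb_mem hθ δ q l B
  have hII : ∀ e e', Integrable (fun ω => (F e ω - p) * (F e' ω - p)) (M.law n θ) := by
    intro e e'
    refine ((hI e').sub (integrable_const p)).bdd_mul (c := 1)
      ((hI e).sub (integrable_const p)).aestronglyMeasurable (Eventually.of_forall fun ω => ?_)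
    rw [Real.norm_eq_abs, abs_le]
    have := hF0 e ω; have := hF1 e ω
    constructor <;> linarith
  have hsq : ∀ ω, (∑ e, (F e ω - p)) ^ 2 = ∑ e, ∑ e', (F e ω - p) * (F e' ω - p) := by
    intro ω; rw [sq, Finset.sum_mul_sum]
  have hS : Integrable (fun ω => ∑ e, ∑ e', (F e ω - p) * (F e' ω - p)) (M.law n θ) :=
    integrable_finsetSum _ fun e _ => integrable_finsetSum _ fun e' _ => hII e e'
  refine ⟨hS.congr (Eventually.of_forall fun ω => (hsq ω).symm), ?_⟩
  refine (integral_congr_ae (Eventually.of_forall hsq)).le.trans ?_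
  rw [integral_finsetSum _ fun e _ => integrable_finsetSum _ fun e' _ => hII e e']
  simp_rw [fun e => integral_finsetSum (μ := M.law n θ) Finset.univ (fun e' _ => hII e e')]
  -- The four indicators cover the possible coincidences of endpoints; their sum is at least 1 as
  -- soon as the edges share a node.
  have hbound : ∀ e e', ∫ ω, (F e ω - p) * (F e' ω - p) ∂(M.law n θ) ≤
      (((if e.1.1 = e'.1.1 then 1 else 0) + (if e.1.1 = e'.1.2 then 1 else 0)) +
      (if e.1.2 = e'.1.1 then 1 else 0)) + (if e.1.2 = e'.1.2 then (1 : ℝ) else 0) := by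
    intro e e'
    by_cases h : e.1.1 ≠ e'.1.1 ∧ e.1.1 ≠ e'.1.2 ∧ e.1.2 ≠ e'.1.1 ∧ e.1.2 ≠ e'.1.2
    · obtain ⟨h1, h2, h3, h4⟩ := h
      have hmul := M.integral_cellInd_mul hθ δ q l hB h1 h2 h3 h4
      have hImul : Integrable (fun ω => F e ω * F e' ω) (M.law n θ) :=
        (hI e').bdd_mul (c := 1) (hI e).aestronglyMeasurable
          (Eventually.of_forall fun ω => norm_cellInd_le_one ..)
      have : ∀ ω, (F e ω - p) * (F e' ω - p) = F e ω * F e' ω - (p * F e ω + p * F e' ω - p ^ 2) :=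
        fun ω => by ring
      simp_rw [this]
      have hA : Integrable (fun ω => p * F e ω + p * F e' ω) (M.law n θ) :=
        ((hI e).const_mul p).add ((hI e').const_mul p)
      have hB' : Integrable (fun ω => p * F e ω + p * F e' ω - p ^ 2) (M.law n θ) :=
        hA.sub (integrable_const _)
      rw [integral_sub hImul hB', integral_sub hA (integrable_const _),
        integral_add ((hI e).const_mul p) ((hI e').const_mul p),
        integral_const_mul, integral_const_mul, hE, hE]
      rw [show ∫ ω, F e ω * F e' ω ∂(M.law n θ) = p ^ 2 from hmul]
      simp [h1, h2, h3, h4]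
      nlinarith
    · have h1 : ∫ ω, (F e ω - p) * (F e' ω - p) ∂(M.law n θ) ≤ 1 := by
        calc _ ≤ ∫ _, (1 : ℝ) ∂(M.law n θ) := by
              refine integral_mono (hII e e') (integrable_const _) fun ω => ?_
              have h1 := hF0 e ω; have h2 := hF1 e ω
              have h3 := hF0 e' ω; have h4 := hF1 e' ω
              refine (le_abs_self _).trans ?_
              rw [abs_mul]
              exact mul_le_one₀ (by rw [abs_le]; constructor <;> linarith) (abs_nonneg _)
                (by rw [abs_le]; constructor <;> linarith)
          _ = 1 := by simp
      refine h1.trans ?_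
      have : e.1.1 = e'.1.1 ∨ e.1.1 = e'.1.2 ∨ e.1.2 = e'.1.1 ∨ e.1.2 = e'.1.2 := by tauto
      split_ifs <;> norm_num
      simp_all only [or_self]
  calc _ ≤ ∑ e : Edge n, ∑ e' : Edge n, ((((if e.1.1 = e'.1.1 then 1 else 0) +
      (if e.1.1 = e'.1.2 then 1 else 0)) +
      (if e.1.2 = e'.1.1 then 1 else 0)) + (if e.1.2 = e'.1.2 then (1 : ℝ) else 0)) :=
        Finset.sum_le_sum fun e _ => Finset.sum_le_sum fun e' _ => hbound e e'
    _ ≤ ∑ e : Edge n, (4 * n : ℝ) := by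
        refine Finset.sum_le_sum fun e _ => ?_
        simp only [Finset.sum_add_distrib, Finset.sum_boole]
        have h1 : ((Finset.univ.filter fun e' : Edge n => e.1.1 = e'.1.1).card : ℝ) ≤ n :=
          mod_cast card_edge_fst _
        have h2 : ((Finset.univ.filter fun e' : Edge n => e.1.1 = e'.1.2).card : ℝ) ≤ n :=
          mod_cast card_edge_snd _
        have h3 : ((Finset.univ.filter fun e' : Edge n => e.1.2 = e'.1.1).card : ℝ) ≤ n :=
          mod_cast card_edge_fst _
        have h4 : ((Finset.univ.filter fun e' : Edge n => e.1.2 = e'.1.2).card : ℝ) ≤ n :=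
          mod_cast card_edge_snd _
        linarith
    _ = _ := by simp; ring

end

/-- The frequency of a cell converges in probability to the probability of the cell. -/
theorem tendsto_freq {θ : Param Q d₀ d₁} (hθ : θ ∈ M.fullParams Q) (δ : Bool) (q l : Fin Q)
    {B : Set ℝ} (hB : MeasurableSet B) {η : ℝ} (hη : 0 < η) :
    Tendsto (fun n => M.law n θ {ω | η ≤ |freq δ q l B ω - M.cellProb θ δ q l B|})
      atTop (𝓝 0) := by
  -- Chebyshev: with `m` edges the bound is `4 n m / (η m)²`, and `2 m = n (n - 1)` gives the
  -- constant 8.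
  have hle : ∀ n, 2 ≤ n → M.law n θ {ω | η ≤ |freq δ q l B ω - M.cellProb θ δ q l B|} ≤
      ENNReal.ofReal (8 / η ^ 2 * (1 / ((n : ℝ) - 1))) := by
    intro n hn
    have hL := M.isProbabilityMeasure_law n hθ
    obtain ⟨hI, hV⟩ := M.integral_sq_le (n := n) hθ δ q l hB
    set m : ℝ := (Fintype.card (Edge n) : ℝ) with hm
    have hn1 : (1 : ℝ) < n := mod_cast hn
    have hcard : 2 * m = n * (n - 1) := by
      have := congrArg (Nat.cast (R := ℝ)) (card_edge n)
      push_cast at this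
      linarith
    have hm0 : 0 < m := by nlinarith
    have hmk := mul_meas_ge_le_integral_of_nonneg (μ := M.law n θ)
      (Eventually.of_forall fun ω => sq_nonneg _) hI ((η * m) ^ 2)
    have hset : {ω : Sample n Q | η ≤ |freq δ q l B ω - M.cellProb θ δ q l B|} ⊆
        {ω : Sample n Q | (η * m) ^ 2 ≤ (∑ e : Edge n,
          (cellInd δ q l B (ω.1 e.1.1) (ω.1 e.1.2) (ω.2.1 e) (ω.2.2 e) -
            M.cellProb θ δ q l B)) ^ 2} := by
      intro ω hω
      simp only [mem_ofPred_eq] at hω ⊢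
      have : ∑ e : Edge n, (cellInd δ q l B (ω.1 e.1.1) (ω.1 e.1.2) (ω.2.1 e) (ω.2.2 e) -
            M.cellProb θ δ q l B) = (freq δ q l B ω - M.cellProb θ δ q l B) * m := by
        rw [Finset.sum_sub_distrib, sub_mul, freq, div_mul_cancel₀ _ hm0.ne']
        simp [cellInd, hm, mul_comm]
      rw [this, ← sq_abs ((_ - _) * m), abs_mul, abs_of_pos hm0]
      exact pow_le_pow_left₀ (by positivity) (mul_le_mul_of_nonneg_right hω hm0.le) 2
    have h2 : (M.law n θ).real {ω : Sample n Q | (η * m) ^ 2 ≤ (∑ e : Edge n,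
          (cellInd δ q l B (ω.1 e.1.1) (ω.1 e.1.2) (ω.2.1 e) (ω.2.2 e) -
            M.cellProb θ δ q l B)) ^ 2} ≤ 8 / η ^ 2 * (1 / ((n : ℝ) - 1)) := by
      have h3 := hmk.trans hV
      rw [← le_div_iff₀' (by positivity)] at h3
      refine h3.trans (le_of_eq ?_)
      have : m = n * (n - 1) / 2 := by linarith
      rw [this]
      have : (n : ℝ) - 1 ≠ 0 := by linarith
      field_simp
      norm_num
    calc _ ≤ _ := measure_mono hset
      _ = ENNReal.ofReal ((M.law n θ).real _) := (ofReal_measureReal).symm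
      _ ≤ _ := ENNReal.ofReal_le_ofReal h2
  have hlim : Tendsto (fun n : ℕ => ENNReal.ofReal (8 / η ^ 2 * (1 / ((n : ℝ) - 1))))
      atTop (𝓝 0) := by
    rw [← ENNReal.ofReal_zero]
    refine ENNReal.tendsto_ofReal ?_
    rw [show (0 : ℝ) = 8 / η ^ 2 * 0 by simp]
    refine Tendsto.const_mul _ ?_
    simp_rw [one_div]
    exact (tendsto_atTop_add_const_right _ (-1) tendsto_natCast_atTop_atTop).inv_tendsto_atTop
  refine tendsto_of_tendsto_of_tendsto_of_le_of_le' tendsto_const_nhds hlim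
    (Eventually.of_forall fun _ => zero_le) ?_
  filter_upwards [eventually_ge_atTop 2] with n hn using hle n hn

end NoiseFamily

/-! ### Glivenko–Cantelli for unions of `K` intervals -/

/-- A finite atomless measure gives mass at most `b - a` to an order-connected set on which its
distribution function takes values in `[a, b]`. -/
theorem measure_le_of_ordConnected (μ : Measure ℝ) [IsFiniteMeasure μ] [NullSingletonClass μ] {S : Set ℝ}
    (hS : S.OrdConnected) {a b : ℝ} (h : ∀ x ∈ S, a ≤ μ.real (Iic x) ∧ μ.real (Iic x) ≤ b) :
    μ S ≤ ENNReal.ofReal (b - a) := by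
  -- `S` need not contain its endpoints. By inner regularity it suffices to treat compact subsets,
  -- whose extreme points lie in `S`, where `h` applies. Absence of atoms then removes the left
  -- endpoint.
  rw [hS.measurableSet.measure_eq_iSup_isCompact]
  refine iSup₂_le fun K hK => iSup_le fun hc => ?_
  rcases K.eq_empty_or_nonempty with rfl | hne
  · simp
  obtain ⟨x, hx⟩ := hc.exists_isLeast hne
  obtain ⟨y, hy⟩ := hc.exists_isGreatest hne
  have hxy : x ≤ y := hx.2 hy.1
  calc μ K ≤ μ (Icc x y) := measure_mono fun z hz => ⟨hx.2 hz, hy.2 hz⟩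
    _ = μ (Ioc x y) := measure_congr Ioc_ae_eq_Icc.symm
    _ = ENNReal.ofReal (μ.real (Ioc x y)) := (ofReal_measureReal).symm
    _ ≤ _ := by
      refine ENNReal.ofReal_le_ofReal ?_
      rw [← Iic_sdiff_Iic, measureReal_sdiff (Iic_subset_Iic.2 hxy) measurableSet_Iic]
      linarith [(h x (hK hx.1)).1, (h y (hK hy.1)).2]

/-- A finite atomless measure on `ℝ` admits a partition of the line into finitely many
consecutive cells of small mass. -/
theorem exists_monotone_cells (μ : Measure ℝ) [IsFiniteMeasure μ] [NullSingletonClass μ] {η : ℝ}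
    (hη : 0 < η) :
    ∃ (N : ℕ) (c : ℝ → ℕ), Monotone c ∧ (∀ x, c x < N) ∧ ∀ k, μ.real (c ⁻¹' {k}) ≤ η := by
  have hmono : Monotone fun x => μ.real (Iic x) := fun x y h =>
    measureReal_mono (Iic_subset_Iic.2 h)
  -- The cell of `x` is read off the distribution function cut into steps of height `η`.
  refine ⟨⌊μ.real univ / η⌋₊ + 1, fun x => ⌊μ.real (Iic x) / η⌋₊, fun x y h => ?_,
    fun x => ?_, fun k => ?_⟩
  · exact Nat.floor_le_floor (div_le_div_of_nonneg_right (hmono h) hη.le)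
  · exact Nat.lt_succ_of_le (Nat.floor_le_floor
      (div_le_div_of_nonneg_right (measureReal_mono (subset_univ _)) hη.le))
  · have hc : Monotone fun x => ⌊μ.real (Iic x) / η⌋₊ := fun x y h =>
      Nat.floor_le_floor (div_le_div_of_nonneg_right (hmono h) hη.le)
    have h := measure_le_of_ordConnected μ (S := (fun x => ⌊μ.real (Iic x) / η⌋₊) ⁻¹' {k})
      (ordConnected_singleton.preimage_mono hc) (a := k * η) (b := (k + 1) * η) (by
        rintro x rfl
        rw [← le_div_iff₀ hη, ← div_le_iff₀ hη]
        exact ⟨Nat.floor_le (by positivity), (Nat.lt_floor_add_one _).le⟩)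
    rw [Measure.real]
    refine ENNReal.toReal_le_of_le_ofReal hη.le (h.trans (le_of_eq ?_))
    congr 1; ring

/-- An interval meets at most two consecutive cells without containing them. -/
theorem exists_boundary_cells {c : ℝ → ℕ} (hc : Monotone c) {I : Set ℝ} (hI : I.OrdConnected) :
    ∃ B : Finset ℕ, B.card ≤ 2 ∧ ∀ k ∉ B, (c ⁻¹' {k} ∩ I).Nonempty → c ⁻¹' {k} ⊆ I := by
  classical
  by_cases hfin : {k | (c ⁻¹' {k} ∩ I).Nonempty ∧ ¬ c ⁻¹' {k} ⊆ I} ⊆ ∅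
  · refine ⟨∅, by simp, fun k _ hk => ?_⟩
    by_contra h
    exact hfin ⟨hk, h⟩
  -- If an interval meets two cells, it contains every cell strictly between them. Hence a cell that
  -- is met but not contained must be the first or the last one met.
  have hmid : ∀ k₁ k₂ k₃, k₁ < k₂ → k₂ < k₃ → (c ⁻¹' {k₁} ∩ I).Nonempty →
      (c ⁻¹' {k₃} ∩ I).Nonempty → c ⁻¹' {k₂} ⊆ I := by
    rintro k₁ k₂ k₃ h1 h2 ⟨x, rfl, hx⟩ ⟨y, rfl, hy⟩ z rfl
    exact hI.out hx hy ⟨(hc.reflect_lt h1).le, (hc.reflect_lt h2).le⟩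
  set T := {k | (c ⁻¹' {k} ∩ I).Nonempty ∧ ¬ c ⁻¹' {k} ⊆ I} with hT
  have hne : ∃ a, a ∈ T := by
    rw [subset_empty_iff] at hfin
    exact nonempty_iff_ne_empty.2 hfin
  obtain ⟨a, ha, hmin⟩ : ∃ a ∈ T, ∀ k ∈ T, a ≤ k :=
    ⟨Nat.find hne, Nat.find_spec hne, fun k hk => Nat.find_min' hne hk⟩
  by_cases hb : ∃ b ∈ T, a < b
  · obtain ⟨b, hbT, hab⟩ := hb
    refine ⟨{a, b}, Finset.card_le_two, fun k hk hk' => ?_⟩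
    simp only [Finset.mem_insert, Finset.mem_singleton, not_or] at hk
    by_contra hsub
    have hkT : k ∈ T := ⟨hk', hsub⟩
    have hak : a < k := lt_of_le_of_ne (hmin k hkT) (Ne.symm hk.1)
    rcases lt_or_gt_of_ne hk.2 with h | h
    · exact hsub (hmid a k b hak h ha.1 hbT.1)
    · exact hbT.2 (hmid a b k hab h ha.1 hk')
  · refine ⟨{a}, by simp, fun k hk hk' => ?_⟩
    by_contra hsub
    have hkT : k ∈ T := ⟨hk', hsub⟩
    exact hb ⟨k, hkT, lt_of_le_of_ne (hmin k hkT) (fun h => hk (by simp [h]))⟩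

/-- Two monotone set functions which are additive over the cells and are close on the cells
are close on unions of `K` intervals. -/
theorem abs_sub_le_of_isUnionOfIntervals {c : ℝ → ℕ} (hc : Monotone c) {N : ℕ}
    (hN : ∀ x, c x < N) {ν₁ ν₂ : Set ℝ → ℝ}
    (hm₁ : Monotone ν₁) (hm₂ : Monotone ν₂)
    (ha₁ : ∀ U : Finset ℕ, ν₁ (c ⁻¹' U) = ∑ k ∈ U, ν₁ (c ⁻¹' {k}))
    (ha₂ : ∀ U : Finset ℕ, ν₂ (c ⁻¹' U) = ∑ k ∈ U, ν₂ (c ⁻¹' {k}))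
    {Δ η : ℝ} (hΔ : ∀ k < N, |ν₁ (c ⁻¹' {k}) - ν₂ (c ⁻¹' {k})| ≤ Δ)
    (hη : ∀ k, ν₂ (c ⁻¹' {k}) ≤ η) (hη0 : 0 ≤ η) {K : ℕ} {S : Set ℝ}
    (hS : IsUnionOfIntervals K S) :
    |ν₁ S - ν₂ S| ≤ N * Δ + 2 * K * η := by
  classical
  obtain ⟨I, hI, rfl⟩ := hS
  choose B hB2 hB using fun k => exists_boundary_cells hc (hI k)
  set S := ⋃ k, I k with hS
  -- `S` is squeezed between the cells it contains (`L`) and those it meets (`U`). The two differ by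
  -- boundary cells only, at most two for each of the `K` intervals.
  set U := (Finset.range N).filter fun k => (c ⁻¹' {k} ∩ S).Nonempty with hU
  set L := (Finset.range N).filter fun k => (c ⁻¹' {k} ∩ S).Nonempty ∧ c ⁻¹' {k} ⊆ S with hL
  set BB : Finset ℕ := Finset.univ.biUnion B with hBB
  have hcard : (BB.card : ℝ) ≤ 2 * K := by
    have : BB.card ≤ ∑ k : Fin K, (B k).card := Finset.card_biUnion_le
    have h2 : ∑ k : Fin K, (B k).card ≤ ∑ k : Fin K, 2 := Finset.sum_le_sum fun k _ => hB2 k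
    simp at h2
    exact_mod_cast (this.trans h2).trans (by omega)
  have hSU : S ⊆ c ⁻¹' U := by
    intro x hx
    simp only [hU, mem_preimage, Finset.coe_filter, Finset.mem_range, mem_ofPred_eq]
    exact ⟨hN x, x, rfl, hx⟩
  have hLS : c ⁻¹' L ⊆ S := by
    intro x hx
    simp only [hL, mem_preimage, Finset.coe_filter, Finset.mem_range, mem_ofPred_eq] at hx
    exact hx.2.2 rfl
  have hLU : L ⊆ U := by
    intro k hk
    simp only [hU, hL, Finset.mem_filter] at hk ⊢
    exact ⟨hk.1, hk.2.1⟩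
  have hUL : U \ L ⊆ BB := by
    intro k hk
    simp only [hU, hL, Finset.mem_sdiff, Finset.mem_filter] at hk
    obtain ⟨⟨hkN, hk1⟩, hk2⟩ := hk
    by_contra hkB
    refine hk2 ⟨hkN, hk1, ?_⟩
    obtain ⟨x, hx, hxS⟩ := hk1
    obtain ⟨j, hj⟩ := mem_iUnion.1 hxS
    have hkj : k ∉ B j := fun h => hkB (Finset.mem_biUnion.2 ⟨j, Finset.mem_univ _, h⟩)
    exact (hB j k hkj ⟨x, hx, hj⟩).trans (subset_iUnion _ _)
  have hUL2 : ν₂ (c ⁻¹' U) - ν₂ (c ⁻¹' L) ≤ 2 * K * η := by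
    rw [ha₂, ha₂, ← Finset.sum_sdiff hLU, add_sub_cancel_right]
    calc ∑ k ∈ U \ L, ν₂ (c ⁻¹' {k}) ≤ ∑ k ∈ U \ L, η := Finset.sum_le_sum fun k _ => hη k
      _ = (U \ L).card * η := by simp
      _ ≤ BB.card * η := by gcongr
      _ ≤ _ := by gcongr
  have hΔ0 : ∀ V ⊆ Finset.range N, |ν₁ (c ⁻¹' V) - ν₂ (c ⁻¹' V)| ≤ N * Δ := by
    intro V hV
    rw [ha₁, ha₂, ← Finset.sum_sub_distrib]
    calc _ ≤ ∑ k ∈ V, |ν₁ (c ⁻¹' {k}) - ν₂ (c ⁻¹' {k})| := Finset.abs_sum_le_sum_abs _ _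
      _ ≤ ∑ k ∈ Finset.range N, |ν₁ (c ⁻¹' {k}) - ν₂ (c ⁻¹' {k})| :=
        Finset.sum_le_sum_of_subset_of_nonneg hV fun _ _ _ => abs_nonneg _
      _ ≤ ∑ k ∈ Finset.range N, Δ :=
        Finset.sum_le_sum fun k hk => hΔ k (Finset.mem_range.1 hk)
      _ = N * Δ := by simp
  have h1 := abs_le.1 (hΔ0 U (Finset.filter_subset _ _))
  have h2 := abs_le.1 (hΔ0 L (Finset.filter_subset _ _))
  have h3 := hm₁ hSU
  have h4 := hm₂ hSU
  have h5 := hm₁ hLS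
  have h6 := hm₂ hLS
  rw [abs_le]
  constructor <;> linarith

namespace NoiseFamily

variable {d₀ d₁ : ℕ} (M : NoiseFamily d₀ d₁) {Q : ℕ}

theorem monotone_freq {n : ℕ} (δ : Bool) (q l : Fin Q) (ω : Sample n Q) :
    Monotone fun B => freq δ q l B ω := by
  classical
  intro B B' h
  unfold freq
  refine div_le_div_of_nonneg_right (Finset.sum_le_sum fun e _ => ?_) (by positivity)
  by_cases h1 : (ω.1 e.1.1 = q ∧ ω.1 e.1.2 = l ∧ ω.2.1 e = δ) ∧ ω.2.2 e ∈ B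
  · rw [if_pos h1, if_pos ⟨h1.1, h h1.2⟩]
  · rw [if_neg h1]
    split_ifs <;> simp

theorem freq_preimage {n : ℕ} (δ : Bool) (q l : Fin Q) (ω : Sample n Q) (c : ℝ → ℕ)
    (U : Finset ℕ) : freq δ q l (c ⁻¹' U) ω = ∑ k ∈ U, freq δ q l (c ⁻¹' {k}) ω := by
  classical
  unfold freq
  rw [← Finset.sum_div, Finset.sum_comm]
  congr 1
  refine Finset.sum_congr rfl fun e _ => ?_
  by_cases h : ω.1 e.1.1 = q ∧ ω.1 e.1.2 = l ∧ ω.2.1 e = δ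
  · simp [h]
  · simp [h]

theorem monotone_cellProb {θ : Param Q d₀ d₁} (hθ : θ ∈ M.fullParams Q) (δ : Bool) (q l : Fin Q) :
    Monotone fun B => M.cellProb θ δ q l B := by
  have hP := M.isProbabilityMeasure_obsLaw hθ δ q l
  intro B B' h
  have h1 := (hθ.1 q).le
  have h2 := (hθ.1 l).le
  have h3 := M.edgeWeight_nonneg hθ δ q l
  unfold cellProb
  have := measureReal_mono (μ := M.obsLaw θ δ q l) h
  beta_reduce
  gcongr

theorem cellProb_preimage {θ : Param Q d₀ d₁} (hθ : θ ∈ M.fullParams Q) (δ : Bool) (q l : Fin Q)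
    {c : ℝ → ℕ} (hc : Measurable c) (U : Finset ℕ) :
    M.cellProb θ δ q l (c ⁻¹' U) = ∑ k ∈ U, M.cellProb θ δ q l (c ⁻¹' {k}) := by
  have hP := M.isProbabilityMeasure_obsLaw hθ δ q l
  simp only [cellProb, ← Finset.mul_sum]
  congr 2
  rw [← measureReal_biUnion_finset
    (fun i _ j _ hij => Disjoint.preimage _ (by simpa using hij))
    (fun k _ => hc (measurableSet_singleton k))]
  congr 1
  ext x; simp

/-- With probability tending to one the frequencies of all unions of `K` intervals are close
to their probabilities. -/
theorem tendsto_freq_uniform {θ : Param Q d₀ d₁} (hθ : θ ∈ M.fullParams Q) (K : ℕ) {η : ℝ}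
    (hη : 0 < η) :
    ∃ G : ∀ n, Set (Sample n Q), Tendsto (fun n => M.law n θ (G n)ᶜ) atTop (𝓝 0) ∧
      ∀ n, ∀ ω ∈ G n, ∀ δ q l S, IsUnionOfIntervals K S →
        |freq δ q l S ω - M.cellProb θ δ q l S| ≤ η := by
  have hP := fun δ q l => M.isProbabilityMeasure_obsLaw hθ δ q l
  have hac : ∀ δ q l, NullSingletonClass (M.obsLaw θ δ q l) := fun δ q l => by
    unfold obsLaw; infer_instance
  -- Summing the observation laws yields a single partition that is fine enough for all `δ`, `q`,
  -- `l` at once.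
  set μ : Measure ℝ := Measure.sum fun p : Bool × Fin Q × Fin Q => M.obsLaw θ p.1 p.2.1 p.2.2
    with hμ
  have hfin : IsFiniteMeasure μ := by rw [hμ, Measure.sum_fintype]; infer_instance
  have hnull : NullSingletonClass μ := ⟨fun x => by
    rw [hμ, Measure.sum_apply _ (measurableSet_singleton x)]; simp⟩
  obtain ⟨N, c, hc, hN, hcell⟩ := exists_monotone_cells μ (η := η / (4 * (K + 1)))
    (by positivity)
  have hsmall : ∀ δ q l k, M.cellProb θ δ q l (c ⁻¹' {k}) ≤ η / (4 * (K + 1)) := by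
    intro δ q l k
    have h1 : (M.obsLaw θ δ q l).real (c ⁻¹' {k}) ≤ μ.real (c ⁻¹' {k}) :=
      ENNReal.toReal_mono (measure_ne_top _ _)
        (Measure.le_sum (fun p : Bool × Fin Q × Fin Q => M.obsLaw θ p.1 p.2.1 p.2.2) (δ, q, l) _)
    refine le_trans ?_ (h1.trans (hcell k))
    unfold cellProb
    have h2 := M.edgeWeight_nonneg hθ δ q l
    exact (mul_le_of_le_one_left (by positivity) (mul_le_one₀ (M.prop_le_one hθ q) (hθ.1 l).le
      (M.prop_le_one hθ l))).trans (mul_le_of_le_one_left (by positivity)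
        (M.edgeWeight_le_one hθ δ q l))
  -- With `N` cells, a deviation below `η / (2 (N + 1))` on each costs at most `η / 2` in total; the
  -- `2 K` boundary cells of mass at most `η / (4 (K + 1))` cost the other half.
  refine ⟨fun n => (⋃ p : Bool × Fin Q × Fin Q × Fin N, {ω | η / (2 * (N + 1)) ≤
    |freq p.1 p.2.1 p.2.2.1 (c ⁻¹' {(p.2.2.2 : ℕ)}) ω -
      M.cellProb θ p.1 p.2.1 p.2.2.1 (c ⁻¹' {(p.2.2.2 : ℕ)})|})ᶜ, ?_, ?_⟩
  · simp_rw [compl_compl]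
    refine tendsto_of_tendsto_of_tendsto_of_le_of_le tendsto_const_nhds ?_
      (fun _ => zero_le) (fun n => measure_iUnion_fintype_le _ _)
    rw [show 𝓝 (0 : ENNReal) = 𝓝 (∑ _p : Bool × Fin Q × Fin Q × Fin N, 0) by simp]
    exact tendsto_finsetSum _ fun p _ => M.tendsto_freq hθ _ _ _
      (hc.measurable (measurableSet_singleton _)) (by positivity)
  · intro n ω hω δ q l S hS
    simp only [mem_compl_iff, mem_iUnion, mem_ofPred_eq, not_exists, not_le] at hω
    refine (abs_sub_le_of_isUnionOfIntervals hc hN (monotone_freq δ q l ω)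
      (M.monotone_cellProb hθ δ q l) (freq_preimage δ q l ω c)
      (M.cellProb_preimage hθ δ q l hc.measurable)
      (fun k hk => (hω (δ, q, l, ⟨k, hk⟩)).le) (hsmall δ q l) (by positivity) hS).trans ?_
    have h1 : (N : ℝ) * (η / (2 * (N + 1))) ≤ η / 2 := by
      rw [← mul_div_assoc, div_le_div_iff₀ (by positivity) (by positivity)]
      nlinarith
    have h2 : 2 * (K : ℝ) * (η / (4 * (K + 1))) ≤ η / 2 := by
      rw [← mul_div_assoc, div_le_div_iff₀ (by positivity) (by positivity)]
      nlinarith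
    linarith

end NoiseFamily

/-! ### The `ℓ`-value as a posterior probability, and monotonicity of the q-value -/

theorem IsDensity.integrable {f : ℝ → ℝ} (hf : IsDensity f) : Integrable f := by
  refine ⟨hf.1.aestronglyMeasurable, ?_⟩
  rw [hasFiniteIntegral_iff_ofReal (Eventually.of_forall hf.2.1), hf.2.2]
  exact ENNReal.one_lt_top

theorem IsDensity.real_withDensity {f : ℝ → ℝ} (hf : IsDensity f) {E : Set ℝ}
    (hE : MeasurableSet E) :
    (volume.withDensity fun x => ENNReal.ofReal (f x)).real E = ∫ x in E, f x := by
  rw [Measure.real, withDensity_apply _ hE, ← ofReal_integral_eq_lintegral_ofReal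
    hf.integrable.integrableOn (Eventually.of_forall hf.2.1), ENNReal.toReal_ofReal]
  exact integral_nonneg hf.2.1

namespace NoiseFamily

variable {d₀ d₁ : ℕ} (M : NoiseFamily d₀ d₁) {Q : ℕ}

theorem cellProb_false_eq {θ : Param Q d₀ d₁} (hθ : θ ∈ M.fullParams Q) (q l : Fin Q) {E : Set ℝ}
    (hE : MeasurableSet E) : M.cellProb θ false q l E =
      θ.prop q * θ.prop l * ∫ x in E, (1 - θ.w q l) * M.g₀ θ.nu0 x := by
  rw [integral_const_mul, ← (M.isDensity_g₀ _ hθ.2.2.2.2.1).real_withDensity hE]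
  simp [cellProb, Param.edgeWeight, obsLaw]

theorem cellProb_true_eq {θ : Param Q d₀ d₁} (hθ : θ ∈ M.fullParams Q) (q l : Fin Q) {E : Set ℝ}
    (hE : MeasurableSet E) : M.cellProb θ true q l E =
      θ.prop q * θ.prop l * ∫ x in E, θ.w q l * M.g (θ.nu q l) x := by
  rw [integral_const_mul, ← (M.isDensity_g _ (hθ.2.2.2.2.2.1 q l)).real_withDensity hE]
  simp [cellProb, Param.edgeWeight, obsLaw]

theorem ell_num_nonneg {θ : Param Q d₀ d₁} (hθ : θ ∈ M.fullParams Q) (q l : Fin Q) (x : ℝ) :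
    0 ≤ (1 - θ.w q l) * M.g₀ θ.nu0 x :=
  mul_nonneg (sub_nonneg.2 (hθ.2.2.1 q l).2.le) ((M.isDensity_g₀ _ hθ.2.2.2.2.1).2.1 x)

theorem ell_alt_nonneg {θ : Param Q d₀ d₁} (hθ : θ ∈ M.fullParams Q) (q l : Fin Q) (x : ℝ) :
    0 ≤ θ.w q l * M.g (θ.nu q l) x :=
  mul_nonneg (hθ.2.2.1 q l).1.le ((M.isDensity_g _ (hθ.2.2.2.2.2.1 q l)).2.1 x)

theorem ell_mem_Icc {θ : Param Q d₀ d₁} (hθ : θ ∈ M.fullParams Q) (q l : Fin Q) (x : ℝ) :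
    M.ell x q l θ ∈ Icc (0 : ℝ) 1 := by
  have h0 := M.ell_num_nonneg hθ q l x
  have h1 := M.ell_alt_nonneg hθ q l x
  exact ⟨div_nonneg h0 (by linarith), div_le_one_of_le₀ (by linarith) (by linarith)⟩

/-- The convention `0 / 0 = 0` does no harm: a vanishing sum of two nonnegative terms forces the
numerator to vanish. -/
theorem ell_mul {θ : Param Q d₀ d₁} (hθ : θ ∈ M.fullParams Q) (q l : Fin Q) (x : ℝ) :
    M.ell x q l θ * ((1 - θ.w q l) * M.g₀ θ.nu0 x + θ.w q l * M.g (θ.nu q l) x) =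
      (1 - θ.w q l) * M.g₀ θ.nu0 x := by
  have h0 := M.ell_num_nonneg hθ q l x
  have h1 := M.ell_alt_nonneg hθ q l x
  refine div_mul_cancel_of_imp fun h => by linarith

/-- On `E` the null share of the density is pointwise the `ℓ`-value; integrating its lower bound `s`
bounds the null share of the mass. -/
theorem le_cellProb {θ : Param Q d₀ d₁} (hθ : θ ∈ M.fullParams Q) (q l : Fin Q) {E : Set ℝ}
    (hE : MeasurableSet E) {s : ℝ} (h : ∀ x ∈ E, s ≤ M.ell x q l θ) :
    s * (M.cellProb θ false q l E + M.cellProb θ true q l E) ≤ M.cellProb θ false q l E := by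
  rw [M.cellProb_false_eq hθ q l hE, M.cellProb_true_eq hθ q l hE, ← mul_add, mul_left_comm]
  refine mul_le_mul_of_nonneg_left ?_ (mul_nonneg (hθ.1 q).le (hθ.1 l).le)
  have i0 := ((M.isDensity_g₀ _ hθ.2.2.2.2.1).integrable.const_mul (1 - θ.w q l)).integrableOn
    (s := E)
  have i1 := ((M.isDensity_g _ (hθ.2.2.2.2.2.1 q l)).integrable.const_mul (θ.w q l)).integrableOn
    (s := E)
  rw [← integral_add i0 i1, ← integral_const_mul]
  refine setIntegral_mono_on ((i0.add i1).const_mul s) i0 hE fun x hx => ?_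
  have h0 := M.ell_num_nonneg hθ q l x
  have h1 := M.ell_alt_nonneg hθ q l x
  conv_rhs => rw [← M.ell_mul hθ q l x]
  exact mul_le_mul_of_nonneg_right (h x hx) (add_nonneg h0 h1)

theorem cellProb_le {θ : Param Q d₀ d₁} (hθ : θ ∈ M.fullParams Q) (q l : Fin Q) {E : Set ℝ}
    (hE : MeasurableSet E) {s : ℝ} (h : ∀ x ∈ E, M.ell x q l θ ≤ s) :
    M.cellProb θ false q l E ≤ s * (M.cellProb θ false q l E + M.cellProb θ true q l E) := by
  rw [M.cellProb_false_eq hθ q l hE, M.cellProb_true_eq hθ q l hE, ← mul_add, mul_left_comm s]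
  refine mul_le_mul_of_nonneg_left ?_ (mul_nonneg (hθ.1 q).le (hθ.1 l).le)
  have i0 := ((M.isDensity_g₀ _ hθ.2.2.2.2.1).integrable.const_mul (1 - θ.w q l)).integrableOn
    (s := E)
  have i1 := ((M.isDensity_g _ (hθ.2.2.2.2.2.1 q l)).integrable.const_mul (θ.w q l)).integrableOn
    (s := E)
  rw [← integral_add i0 i1, ← integral_const_mul]
  refine setIntegral_mono_on i0 ((i0.add i1).const_mul s) hE fun x hx => ?_
  have h0 := M.ell_num_nonneg hθ q l x
  have h1 := M.ell_alt_nonneg hθ q l x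
  conv_lhs => rw [← M.ell_mul hθ q l x]
  exact mul_le_mul_of_nonneg_right (h x hx) (by linarith)

/-- The probability under `P_{θ'}` that an edge has status `δ` and an `ℓ`-value at `θ` of at
most `t`. -/
def mass (δ : Bool) (θ' θ : Param Q d₀ d₁) (t : ℝ) : ℝ :=
  ∑ q, ∑ l, M.cellProb θ' δ q l {x | M.ell x q l θ ≤ t}

theorem qVal_eq_mass (θ' θ : Param Q d₀ d₁) (t : ℝ) :
    M.qVal θ' θ t = M.mass false θ' θ t / (M.mass false θ' θ t + M.mass true θ' θ t) := by
  simp only [mass, ← Finset.sum_add_distrib]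
  simp [qVal, cellProb, Param.edgeWeight, qFun, mul_add]

theorem measurableSet_ell_le {θ : Param Q d₀ d₁} (hθ : θ ∈ M.fullParams Q) (q l : Fin Q) (t : ℝ) :
    MeasurableSet {x | M.ell x q l θ ≤ t} :=
  measurableSet_le (M.measurable_ell hθ q l) measurable_const

theorem mass_nonneg {θ' : Param Q d₀ d₁} (hθ' : θ' ∈ M.fullParams Q) (δ : Bool)
    (θ : Param Q d₀ d₁) (t : ℝ) : 0 ≤ M.mass δ θ' θ t :=
  Finset.sum_nonneg fun q _ => Finset.sum_nonneg fun l _ => (M.cellProb_mem hθ' δ q l _).1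

theorem monotone_mass {θ' : Param Q d₀ d₁} (hθ' : θ' ∈ M.fullParams Q) (δ : Bool)
    (θ : Param Q d₀ d₁) : Monotone (M.mass δ θ' θ) := fun _ _ h =>
  Finset.sum_le_sum fun q _ => Finset.sum_le_sum fun l _ =>
    M.monotone_cellProb hθ' δ q l fun _ hx => le_trans hx h

theorem cellProb_ell_sub {θ : Param Q d₀ d₁} (hθ : θ ∈ M.fullParams Q) (δ : Bool) (q l : Fin Q)
    {s t : ℝ} (hst : s ≤ t) :
    M.cellProb θ δ q l {x | M.ell x q l θ ≤ t} - M.cellProb θ δ q l {x | M.ell x q l θ ≤ s} =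
      M.cellProb θ δ q l ({x | M.ell x q l θ ≤ t} \ {x | M.ell x q l θ ≤ s}) := by
  have hP := M.isProbabilityMeasure_obsLaw hθ δ q l
  have hsub : {x | M.ell x q l θ ≤ s} ⊆ {x | M.ell x q l θ ≤ t} := fun x hx => le_trans hx hst
  rw [cellProb, cellProb, cellProb, measureReal_sdiff hsub (M.measurableSet_ell_le hθ q l s)]
  ring

/-- The mass gained between the levels sits where the `ℓ`-value exceeds `s`, so its null share is at
least `s`. -/
theorem mul_mass_sub_le {θ : Param Q d₀ d₁} (hθ : θ ∈ M.fullParams Q) {s t : ℝ} (hst : s ≤ t) :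
    s * ((M.mass false θ θ t + M.mass true θ θ t) - (M.mass false θ θ s + M.mass true θ θ s)) ≤
      M.mass false θ θ t - M.mass false θ θ s := by
  rw [add_sub_add_comm]
  simp only [mass, ← Finset.sum_sub_distrib, ← Finset.sum_add_distrib, Finset.mul_sum]
  refine Finset.sum_le_sum fun q _ => Finset.sum_le_sum fun l _ => ?_
  rw [M.cellProb_ell_sub hθ _ q l hst, M.cellProb_ell_sub hθ _ q l hst]
  exact M.le_cellProb hθ q l ((M.measurableSet_ell_le hθ q l t).diff
    (M.measurableSet_ell_le hθ q l s)) fun x hx => (not_le.1 hx.2).le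

theorem mass_false_le {θ : Param Q d₀ d₁} (hθ : θ ∈ M.fullParams Q) (s : ℝ) :
    M.mass false θ θ s ≤ s * (M.mass false θ θ s + M.mass true θ θ s) := by
  simp only [mass, ← Finset.sum_add_distrib, Finset.mul_sum]
  exact Finset.sum_le_sum fun q _ => Finset.sum_le_sum fun l _ =>
    M.cellProb_le hθ q l (M.measurableSet_ell_le hθ q l s) fun x hx => hx

theorem qVal_nonneg {θ' : Param Q d₀ d₁} (hθ' : θ' ∈ M.fullParams Q) (θ : Param Q d₀ d₁) (t : ℝ) :
    0 ≤ M.qVal θ' θ t := by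
  rw [qVal_eq_mass]
  have h0 := M.mass_nonneg hθ' false θ t
  have h1 := M.mass_nonneg hθ' true θ t
  positivity

/-- The null share below `s` is at most `s`, while that of the mass added up to `t` is at least `s`,
so adding this mass cannot lower the ratio. -/
theorem monotone_qVal {θ : Param Q d₀ d₁} (hθ : θ ∈ M.fullParams Q) : Monotone (M.qVal θ θ) := by
  intro s t hst
  have h0 := M.mass_nonneg hθ false θ s
  have h1 := M.mass_nonneg hθ true θ s
  have h2 := M.monotone_mass hθ false θ hst
  have h3 := M.monotone_mass hθ true θ hst
  have h4 := M.mul_mass_sub_le hθ hst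
  have h5 := M.mass_false_le hθ s
  rcases (add_nonneg h0 h1).eq_or_lt with h | h
  · calc M.qVal θ θ s = 0 := by rw [qVal_eq_mass, ← h, div_zero]
      _ ≤ _ := M.qVal_nonneg hθ θ t
  rw [qVal_eq_mass, qVal_eq_mass, div_le_div_iff₀ h (by linarith)]
  nlinarith [mul_le_mul_of_nonneg_right h4 h.le, mul_le_mul_of_nonneg_right h5
    (show 0 ≤ (M.mass false θ θ t + M.mass true θ θ t) -
      (M.mass false θ θ s + M.mass true θ θ s) by linarith)]

/-! ### Consequences of regularity: uniform closeness and thresholds -/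

variable {Θ : Set (Param Q d₀ d₁)} {t₁ t₂ : Fin Q → Fin Q → Param Q d₀ d₁ → ℝ}

theorem continuousOn_mass (hreg : M.Regularity Θ t₁ t₂) (δ : Bool) :
    ContinuousOn (fun p : ℝ × Param Q d₀ d₁ × Param Q d₀ d₁ => M.mass δ p.2.2 p.2.1 p.1)
      (Icc 0 1 ×ˢ Θ ×ˢ Θ) := by
  unfold mass cellProb
  refine continuousOn_finsetSum _ fun q _ => continuousOn_finsetSum _ fun l _ => ?_
  refine ContinuousOn.mul (Continuous.continuousOn ?_)
    (ContinuousOn.mul (Continuous.continuousOn ?_) (hreg.continuousOn δ q l))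
  · unfold Param.prop; fun_prop
  · unfold Param.edgeWeight Param.w
    cases δ
    · simp only [Bool.false_eq_true, if_false]; fun_prop
    · simp only [if_true]; fun_prop

theorem continuousOn_mass_right (hreg : M.Regularity Θ t₁ t₂) (δ : Bool) {θ' θ : Param Q d₀ d₁}
    (hθ' : θ' ∈ Θ) (hθ : θ ∈ Θ) : ContinuousOn (M.mass δ θ' θ) (Icc 0 1) :=
  (M.continuousOn_mass hreg δ).comp (f := fun t : ℝ => (t, θ, θ')) (by fun_prop)
    fun _ ht => ⟨ht, hθ, hθ'⟩

theorem mass_zero (hreg : M.Regularity Θ t₁ t₂) (δ : Bool) {θ' θ : Param Q d₀ d₁}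
    (hθ' : θ' ∈ Θ) (hθ : θ ∈ Θ) : M.mass δ θ' θ 0 = 0 := by
  refine Finset.sum_eq_zero fun q _ => Finset.sum_eq_zero fun l _ => ?_
  have := hreg.eq_zero δ q l θ hθ θ' hθ' 0 ⟨le_rfl, (hreg.t₁_mem q l θ hθ).1⟩
  unfold qFun at this
  rw [cellProb, this]; simp

/-- Joint continuity and compactness of `[0, 1]` give closeness uniformly in `t`; no compactness of
`Θ` is involved. The first bound moves only the parameter defining the `ℓ`-values, the second also
moves the law. -/
theorem exists_mass_close (hreg : M.Regularity Θ t₁ t₂) {θ₀ : Param Q d₀ d₁} (hθ₀ : θ₀ ∈ Θ)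
    {η : ℝ} (hη : 0 < η) :
    ∃ ε > 0, ∀ θ ∈ Θ, ‖θ - θ₀‖ < ε → ∀ δ, ∀ t ∈ Icc (0 : ℝ) 1,
      |M.mass δ θ₀ θ t - M.mass δ θ₀ θ₀ t| ≤ η ∧ |M.mass δ θ θ t - M.mass δ θ₀ θ₀ t| ≤ η := by
  have key : ∀ δ, ∃ ε > 0, ∀ θ ∈ Θ, ∀ θ' ∈ Θ, ‖θ - θ₀‖ < ε → ‖θ' - θ₀‖ < ε →
      ∀ t ∈ Icc (0 : ℝ) 1, |M.mass δ θ' θ t - M.mass δ θ₀ θ₀ t| < η := by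
    intro δ
    have hc : ContinuousOn (Function.uncurry
        fun (p : Param Q d₀ d₁ × Param Q d₀ d₁) (t : ℝ) => M.mass δ p.2 p.1 t)
        ((Θ ×ˢ Θ) ×ˢ Icc (0 : ℝ) 1) :=
      (M.continuousOn_mass hreg δ).comp 
        (f := fun x : (Param Q d₀ d₁ × Param Q d₀ d₁) × ℝ => (x.2, x.1))
        (continuous_snd.prodMk continuous_fst).continuousOn fun _ hx => ⟨hx.2, hx.1⟩
    obtain ⟨v, hv, hvt⟩ := isCompact_Icc.mem_uniformity_of_prod hc
      (show (θ₀, θ₀) ∈ Θ ×ˢ Θ from ⟨hθ₀, hθ₀⟩) (Metric.dist_mem_uniformity hη)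
    obtain ⟨ε, hε, hball⟩ := Metric.mem_nhdsWithin_iff.1 hv
    refine ⟨ε, hε, fun θ hθ θ' hθ' h h' t ht => ?_⟩
    have := hvt (θ, θ') (hball ⟨by
      rw [Metric.mem_ball, Prod.dist_eq, max_lt_iff, dist_eq_norm, dist_eq_norm]
      exact ⟨h, h'⟩, hθ, hθ'⟩) t ht
    simpa [Real.dist_eq] using this
  obtain ⟨ε₁, h₁, hf⟩ := key false
  obtain ⟨ε₂, h₂, ht⟩ := key true
  have h0 : ‖θ₀ - θ₀‖ < min ε₁ ε₂ := by simpa using ⟨h₁, h₂⟩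
  refine ⟨min ε₁ ε₂, lt_min h₁ h₂, fun θ hθ h δ t hti => ?_⟩
  cases δ
  · exact ⟨(hf θ hθ θ₀ hθ₀ (h.trans_le (min_le_left _ _)) (h0.trans_le (min_le_left _ _)) t hti).le,
      (hf θ hθ θ hθ (h.trans_le (min_le_left _ _)) (h.trans_le (min_le_left _ _)) t hti).le⟩
  · exact ⟨(ht θ hθ θ₀ hθ₀ (h.trans_le (min_le_right _ _)) (h0.trans_le (min_le_right _ _))
      t hti).le,
      (ht θ hθ θ hθ (h.trans_le (min_le_right _ _)) (h.trans_le (min_le_right _ _)) t hti).le⟩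

/-- Strictness comes from an intermediate level `u > s` splitting the added mass in half: the upper
half has null share at least `u`, hence strictly more than `s`. -/
theorem qVal_lt_of_mass_lt (hΘ : Θ ⊆ M.fullParams Q) (hreg : M.Regularity Θ t₁ t₂)
    {θ : Param Q d₀ d₁} (hθ : θ ∈ Θ) {s t : ℝ} (hs : 0 ≤ s) (hst : s ≤ t) (ht : t ≤ 1)
    (hpos : 0 < M.mass false θ θ s + M.mass true θ θ s)
    (hlt : M.mass false θ θ s + M.mass true θ θ s < M.mass false θ θ t + M.mass true θ θ t) :
    M.qVal θ θ s < M.qVal θ θ t := by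
  have hc : ContinuousOn (fun u => M.mass false θ θ u + M.mass true θ θ u) (Icc s t) :=
    ((M.continuousOn_mass_right hreg false hθ hθ).add
      (M.continuousOn_mass_right hreg true hθ hθ)).mono (Icc_subset_Icc hs ht)
  obtain ⟨u, hu, huv⟩ := intermediate_value_Ioo hst hc
    (show (M.mass false θ θ s + M.mass true θ θ s + (M.mass false θ θ t + M.mass true θ θ t)) / 2 ∈
      Ioo _ _ from ⟨by linarith, by linarith⟩)
  dsimp only at huv
  have h1 := M.mul_mass_sub_le (hΘ hθ) hu.1.le
  have h2 := M.mul_mass_sub_le (hΘ hθ) hu.2.le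
  have h3 := M.mass_false_le (hΘ hθ) s
  rw [qVal_eq_mass, qVal_eq_mass, div_lt_div_iff₀ hpos (by linarith)]
  set a := M.mass false θ θ s + M.mass true θ θ s
  set b := M.mass false θ θ t + M.mass true θ θ t
  have h4 : s * (b - (a + b) / 2) < M.mass false θ θ t - M.mass false θ θ u := by
    refine lt_of_lt_of_le (mul_lt_mul_of_pos_right hu.1 (by linarith)) ?_
    rw [← huv]; exact h2
  rw [huv] at h1
  have h5 : s * (b - a) < M.mass false θ θ t - M.mass false θ θ s := by linarith
  nlinarith [mul_lt_mul_of_pos_right h5 hpos, mul_le_mul_of_nonneg_right h3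
    (show 0 ≤ b - a by linarith)]

/-- The set of levels with marginal false discovery rate at most `α` is a closed interval. -/
theorem exists_threshold (hΘ : Θ ⊆ M.fullParams Q) (hreg : M.Regularity Θ t₁ t₂)
    {θ : Param Q d₀ d₁} (hθ : θ ∈ Θ) {α : ℝ} (hα : 0 ≤ α) :
    ∃ τ ∈ Icc (0 : ℝ) 1, ∀ t ∈ Icc (0 : ℝ) 1, M.qVal θ θ t ≤ α ↔ t ≤ τ := by
  set A := {t ∈ Icc (0 : ℝ) 1 | M.qVal θ θ t ≤ α} with hA
  have h0 : (0 : ℝ) ∈ A := ⟨⟨le_rfl, zero_le_one⟩, by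
    rw [qVal_eq_mass, M.mass_zero hreg false hθ hθ, zero_div]; exact hα⟩
  have hbdd : BddAbove A := ⟨1, fun t ht => ht.1.2⟩
  have hτ : sSup A ∈ Icc (0 : ℝ) 1 := ⟨le_csSup hbdd h0, csSup_le ⟨0, h0⟩ fun t ht => ht.1.2⟩
  refine ⟨sSup A, hτ, fun t ht => ⟨fun h => le_csSup hbdd ⟨ht, h⟩, fun h => ?_⟩⟩
  refine (M.monotone_qVal (hΘ hθ) h).trans ?_
  have hn0 := M.mass_nonneg (hΘ hθ) false θ (sSup A)
  have hn1 := M.mass_nonneg (hΘ hθ) true θ (sSup A)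
  -- Where no mass is selected the q-value is 0 by convention. Elsewhere the ratio is continuous, so
  -- the bound passes to the supremum.
  rcases (add_nonneg hn0 hn1).eq_or_lt with hz | hz
  · rw [qVal_eq_mass, ← hz, div_zero]; exact hα
  have hcont : ContinuousWithinAt (M.qVal θ θ) (Icc 0 1) (sSup A) := by
    rw [funext (M.qVal_eq_mass θ θ)]
    have c0 := M.continuousOn_mass_right hreg false hθ hθ _ hτ
    have c1 := M.continuousOn_mass_right hreg true hθ hθ _ hτ
    exact c0.div (c0.add c1) hz.ne'
  have hcl : sSup A ∈ closure A := csSup_mem_closure ⟨0, h0⟩ hbdd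
  have : (𝓝[A] sSup A).NeBot := mem_closure_iff_nhdsWithin_neBot.1 hcl
  have hsub : A ⊆ Icc 0 1 := fun t ht => ht.1
  exact le_of_tendsto (hcont.mono hsub)
    (eventually_nhdsWithin_of_forall fun t (ht : t ∈ A) => ht.2)

/-- By monotonicity the right limit defining `alphaStar` exists, so q-values are below `α` just
above the smallest `t₁`; there the strict increase of `qFun` for a minimising pair of groups makes
the mass positive. -/
theorem exists_qVal_lt (hΘ : Θ ⊆ M.fullParams Q) (hreg : M.Regularity Θ t₁ t₂)
    {θ₀ : Param Q d₀ d₁} (hθ₀ : θ₀ ∈ Θ) {α : ℝ} (hα : M.alphaStar t₁ θ₀ < α) :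
    0 < α ∧ ∃ t ∈ Icc (0 : ℝ) 1, M.qVal θ₀ θ₀ t < α ∧
      0 < M.mass false θ₀ θ₀ t + M.mass true θ₀ θ₀ t := by
  have hmono := M.monotone_qVal (hΘ hθ₀)
  have hlim : Tendsto (M.qVal θ₀ θ₀) (𝓝[>] (⨅ p : Fin Q × Fin Q, t₁ p.1 p.2 θ₀))
      (𝓝 (M.alphaStar t₁ θ₀)) := by
    have h := hmono.tendsto_nhdsGT (⨅ p : Fin Q × Fin Q, t₁ p.1 p.2 θ₀)
    rw [alphaStar, h.limUnder_eq]; exact h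
  have hQ : Nonempty (Fin Q × Fin Q) := by
    have : Nonempty (Fin Q) := by
      by_contra hne
      rw [not_nonempty_iff] at hne
      have := (hΘ hθ₀).2.1
      simp at this
    infer_instance
  obtain ⟨p, hp⟩ := exists_eq_ciInf_of_finite (f := fun p : Fin Q × Fin Q => t₁ p.1 p.2 θ₀)
  rw [← hp] at hlim
  have h0 := (hreg.t₁_mem p.1 p.2 θ₀ hθ₀).1
  have h2 := hreg.t₁_lt_t₂ p.1 p.2 θ₀ hθ₀
  have h3 := (hreg.t₂_mem p.1 p.2 θ₀ hθ₀).2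
  refine ⟨lt_of_le_of_lt (ge_of_tendsto' hlim fun t => M.qVal_nonneg (hΘ hθ₀) θ₀ t) hα, ?_⟩
  obtain ⟨t, hlt, ht1, ht2⟩ := ((hlim.eventually_lt_const hα).and
    (Ioo_mem_nhdsGT h2)).exists
  refine ⟨t, ⟨h0.trans ht1.le, ht2.le.trans h3⟩, hlt, ?_⟩
  refine add_pos_of_pos_of_nonneg ?_ (M.mass_nonneg (hΘ hθ₀) true θ₀ t)
  have hq : 0 < M.qFun false t p.1 p.2 θ₀ θ₀ := by
    have := hreg.strictMonoOn false p.1 p.2 θ₀ hθ₀ θ₀ hθ₀ ⟨le_rfl, h2.le⟩ ⟨ht1.le, ht2.le⟩ ht1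
    beta_reduce at this
    rwa [hreg.eq_zero false p.1 p.2 θ₀ hθ₀ θ₀ hθ₀ _ ⟨h0, le_rfl⟩] at this
  have hcell : 0 < M.cellProb θ₀ false p.1 p.2 {x | M.ell x p.1 p.2 θ₀ ≤ t} := by
    have hw : 0 < θ₀.edgeWeight false p.1 p.2 := by
      simpa [Param.edgeWeight] using ((hΘ hθ₀).2.2.1 p.1 p.2).2
    exact mul_pos (mul_pos ((hΘ hθ₀).1 _) ((hΘ hθ₀).1 _)) (mul_pos hw hq)
  have hnn := fun q l => (M.cellProb_mem (hΘ hθ₀) false q l {x | M.ell x q l θ₀ ≤ t}).1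
  exact Finset.sum_pos' (fun q _ => Finset.sum_nonneg fun l _ => hnn q l)
    ⟨p.1, Finset.mem_univ _, Finset.sum_pos' (fun l _ => hnn _ l) ⟨p.2, Finset.mem_univ _, hcell⟩⟩

/-- There is a level with marginal false discovery rate smaller than `α` and almost the same
power as the procedure at level `α`. -/
theorem exists_level (hΘ : Θ ⊆ M.fullParams Q) (hreg : M.Regularity Θ t₁ t₂)
    {θ₀ : Param Q d₀ d₁} (hθ₀ : θ₀ ∈ Θ) {α : ℝ} (hα : M.alphaStar t₁ θ₀ < α) {τ : ℝ}
    (hτ : τ ∈ Icc (0 : ℝ) 1) (hτα : ∀ t ∈ Icc (0 : ℝ) 1, M.qVal θ₀ θ₀ t ≤ α ↔ t ≤ τ) {η : ℝ}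
    (hη : 0 < η) :
    ∃ s ∈ Icc (0 : ℝ) 1, M.qVal θ₀ θ₀ s < α ∧
      0 < M.mass false θ₀ θ₀ s + M.mass true θ₀ θ₀ s ∧
      M.mass true θ₀ θ₀ τ ≤ M.mass true θ₀ θ₀ s + η := by
  obtain ⟨-, t, ht, htα, htpos⟩ := M.exists_qVal_lt hΘ hreg hθ₀ hα
  have htτ := (hτα t ht).1 htα.le
  have hm := fun δ => M.monotone_mass (hΘ hθ₀) δ θ₀
  have hpos : 0 < M.mass false θ₀ θ₀ τ + M.mass true θ₀ θ₀ τ :=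
    htpos.trans_le (add_le_add (hm _ htτ) (hm _ htτ))
  set D := fun u => M.mass false θ₀ θ₀ u + M.mass true θ₀ θ₀ u with hD
  have hc : ContinuousOn D (Icc 0 τ) :=
    ((M.continuousOn_mass_right hreg false hθ₀ hθ₀).add
      (M.continuousOn_mass_right hreg true hθ₀ hθ₀)).mono (Icc_subset_Icc le_rfl hτ.2)
  have hD0 : D 0 = 0 := by simp [hD, M.mass_zero hreg _ hθ₀ hθ₀]
  have h1 : 0 < min η (D τ / 2) := lt_min hη (half_pos hpos)
  have h2 : min η (D τ / 2) ≤ D τ / 2 := min_le_right _ _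
  have hpos' : 0 < D τ := hpos
  -- Lowering the total mass strictly makes the q-value strictly smaller. Removing at most `η`
  -- bounds the loss of true discoveries, and removing at most half keeps the mass positive.
  obtain ⟨s, hs, hsv⟩ := intermediate_value_Icc hτ.1 hc
    (show D τ - min η (D τ / 2) ∈ Icc _ _ from ⟨by rw [hD0]; linarith, by linarith⟩)
  have hspos : 0 < D s := by linarith
  refine ⟨s, ⟨hs.1, hs.2.trans hτ.2⟩, ?_, hspos, ?_⟩
  · exact (M.qVal_lt_of_mass_lt hΘ hreg hθ₀ hs.1 hs.2 hτ.2 hspos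
      (show D s < D τ by linarith)).trans_le ((hτα τ hτ).2 le_rfl)
  · have h3 := hm false hs.2
    have h4 : min η (D τ / 2) ≤ η := min_le_left _ _
    simp only [hD] at hsv h4
    linarith

end NoiseFamily

/-! ### Label switching and bounded expectations -/

theorem toReal_nonneg (b : Bool) : 0 ≤ toReal b := by cases b <;> simp [toReal]

theorem toReal_le_one (b : Bool) : toReal b ≤ 1 := by cases b <;> simp [toReal]

theorem measurable_toReal : Measurable toReal := measurable_from_top

/-- A parameter and a clustering which are close up to label switching can be relabelled in such
a way that the parameters are close and the memberships agree. -/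
theorem exists_perm_of_labelDist_lt {n Q d₀ d₁ : ℕ} {θ' θ : Param Q d₀ d₁} {Z' Z : Fin n → Fin Q}
    {ε : ℝ} (hε : ε ≤ 1) (h : labelDist θ' Z' θ Z < ε) :
    ∃ σ : Equiv.Perm (Fin Q), ‖θ'.perm σ - θ‖ < ε ∧ Z' = fun i => σ (Z i) := by
  obtain ⟨σ, -, hσ⟩ := (Finset.inf'_lt_iff _).1 h
  refine ⟨σ, (le_max_left _ _).trans_lt hσ, funext fun i => ?_⟩
  -- Labels are integers, so a distance below 1 forces equality.
  have h1 := ((norm_le_pi_norm _ i).trans (le_max_right _ _)).trans_lt (hσ.trans_le hε)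
  rw [Real.norm_eq_abs] at h1
  have h2 : |((Z' i : ℕ) : ℤ) - ((σ (Z i) : ℕ) : ℤ)| < 1 := by exact_mod_cast h1
  rw [Int.abs_lt_one_iff] at h2
  exact Fin.ext (by omega)

/-- A function which is at most `c` on `H` and at most `c + 1` everywhere has expectation at most
`c` plus the probability of the complement of `H`. -/
theorem integral_le_add_measureReal_compl {Ω : Type*} [MeasurableSpace Ω] (μ : Measure Ω)
    [IsProbabilityMeasure μ] {f : Ω → ℝ} (hf : Integrable f μ) {c : ℝ} {H : Set Ω}
    (h : ∀ ω ∈ H, f ω ≤ c) (h1 : ∀ ω, f ω ≤ c + 1) : ∫ ω, f ω ∂μ ≤ c + μ.real Hᶜ := by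
  classical
  -- `H` need not be measurable; its complement is replaced by a measurable hull of the same
  -- measure.
  have hT := measurableSet_toMeasurable μ Hᶜ
  have hI : Integrable ((toMeasurable μ Hᶜ).indicator (1 : Ω → ℝ)) μ :=
    (integrable_const (1 : ℝ)).indicator hT
  calc ∫ ω, f ω ∂μ ≤ ∫ ω, (c + (toMeasurable μ Hᶜ).indicator 1 ω) ∂μ := by
        refine integral_mono hf ((integrable_const c).add hI) fun ω => ?_
        by_cases hω : ω ∈ H
        · exact (h ω hω).trans (le_add_of_nonneg_right (indicator_nonneg (by simp) _))
        · have : ω ∈ toMeasurable μ Hᶜ := subset_toMeasurable μ _ hω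
          simpa [indicator_of_mem this] using h1 ω
    _ = c + μ.real Hᶜ := by
        rw [integral_add (integrable_const c) hI, integral_indicator_one hT]
        simp [Measure.real, measure_toMeasurable]

namespace NoiseFamily

variable {d₀ d₁ : ℕ} (M : NoiseFamily d₀ d₁) {Q : ℕ}

theorem qVal_perm (σ : Equiv.Perm (Fin Q)) (θ' θ : Param Q d₀ d₁) (t : ℝ) :
    M.qVal (θ'.perm σ) (θ.perm σ) t = M.qVal θ' θ t := by
  have key : ∀ F : Fin Q → Fin Q → ℝ, ∑ q, ∑ l, F (σ q) (σ l) = ∑ q, ∑ l, F q l := by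
    intro F
    rw [← Equiv.sum_comp σ (fun q => ∑ l, F q l)]
    exact Finset.sum_congr rfl fun q _ => Equiv.sum_comp σ (F (σ q))
  unfold qVal
  exact congrArg₂ (· / ·)
    (key fun q l => θ'.prop q * θ'.prop l * ((1 - θ'.w q l) * M.qFun false t q l θ' θ))
    (key fun q l => θ'.prop q * θ'.prop l *
      ((1 - θ'.w q l) * M.qFun false t q l θ' θ + θ'.w q l * M.qFun true t q l θ' θ))

/-- A permutation of the labels in the clustering can be transferred to the parameter, since the
q-value depends on the labels only through sums over all groups. -/
theorem qProc_perm {n : ℕ} (α : ℝ) (σ : Equiv.Perm (Fin Q)) (θ : Param Q d₀ d₁)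
    (z : Fin n → Fin Q) (x : Edge n → ℝ) (e : Edge n) :
    M.qProc α θ (fun i => σ (z i)) x e = M.qProc α (θ.perm σ) z x e := by
  simp only [qProc, qVal_perm]
  rfl

/-! ### Empirical masses and the good event -/

/-- The frequency of the edges with status `δ` and `ℓ`-value at `θ` at most `t`. -/
def empMass {n : ℕ} (δ : Bool) (θ : Param Q d₀ d₁) (t : ℝ) (ω : Sample n Q) : ℝ :=
  ∑ q, ∑ l, freq δ q l {x | M.ell x q l θ ≤ t} ω

theorem empMass_eq {n : ℕ} (δ : Bool) (θ : Param Q d₀ d₁) (t : ℝ) (ω : Sample n Q) :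
    M.empMass δ θ t ω = (∑ e : Edge n, toReal (ω.2.1 e == δ) *
      toReal (decide (M.ell (ω.2.2 e) (ω.1 e.1.1) (ω.1 e.1.2) θ ≤ t))) /
        Fintype.card (Edge n) := by
  classical
  unfold empMass freq
  simp_rw [← Finset.sum_div]
  congr 1
  simp_rw [fun q => Finset.sum_comm (s := (Finset.univ : Finset (Fin Q)))
    (t := (Finset.univ : Finset (Edge n)))
    (f := fun l e => if (ω.1 e.1.1 = q ∧ ω.1 e.1.2 = l ∧ ω.2.1 e = δ) ∧
      ω.2.2 e ∈ {x | M.ell x q l θ ≤ t} then (1 : ℝ) else 0)]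
  rw [Finset.sum_comm]
  refine Finset.sum_congr rfl fun e _ => ?_
  rw [Finset.sum_eq_single (ω.1 e.1.1), Finset.sum_eq_single (ω.1 e.1.2)]
  · simp only [true_and, mem_ofPred_eq, toReal, beq_iff_eq, decide_eq_true_eq, ite_and, mul_ite,
      mul_one, mul_zero]
    split_ifs <;> rfl
  · intro l _ hl; rw [if_neg]; exact fun h => hl h.1.2.1.symm
  · simp
  · intro q _ hq
    refine Finset.sum_eq_zero fun l _ => ?_
    rw [if_neg]; exact fun h => hq h.1.1.symm
  · simp

theorem card_mul_empMass {n : ℕ} (δ : Bool) (θ : Param Q d₀ d₁) (t : ℝ) (ω : Sample n Q) :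
    Fintype.card (Edge n) * M.empMass δ θ t ω = ∑ e : Edge n, toReal (ω.2.1 e == δ) *
      toReal (decide (M.ell (ω.2.2 e) (ω.1 e.1.1) (ω.1 e.1.2) θ ≤ t)) := by
  rw [empMass_eq]
  rcases eq_or_ne (Fintype.card (Edge n) : ℝ) 0 with h | h
  · have : IsEmpty (Edge n) := Fintype.card_eq_zero_iff.1 (by exact_mod_cast h)
    simp
  · exact mul_div_cancel₀ _ h

theorem integral_freq {n : ℕ} (hn : 2 ≤ n) {θ : Param Q d₀ d₁} (hθ : θ ∈ M.fullParams Q)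
    (δ : Bool) (q l : Fin Q) {B : Set ℝ} (hB : MeasurableSet B) :
    Integrable (fun ω : Sample n Q => freq δ q l B ω) (M.law n θ) ∧
      ∫ ω : Sample n Q, freq δ q l B ω ∂(M.law n θ) = M.cellProb θ δ q l B := by
  classical
  have hm : (Fintype.card (Edge n) : ℝ) ≠ 0 := by
    have : Nonempty (Edge n) := ⟨⟨(⟨0, by omega⟩, ⟨1, by omega⟩), by simp⟩⟩
    exact_mod_cast Fintype.card_ne_zero
  have h := fun e : Edge n => M.integral_cellInd hθ δ q l hB e
  have heq : (fun ω : Sample n Q => freq δ q l B ω) = fun ω => (∑ e : Edge n,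
      cellInd δ q l B (ω.1 e.1.1) (ω.1 e.1.2) (ω.2.1 e) (ω.2.2 e)) / Fintype.card (Edge n) := by
    ext ω; simp only [freq, cellInd]
  rw [heq]
  refine ⟨(integrable_finsetSum _ fun e _ => (h e).1).div_const _, ?_⟩
  rw [integral_div, integral_finsetSum _ fun e _ => (h e).1]
  simp_rw [fun e => (h e).2]
  rw [Finset.sum_const, Finset.card_univ, nsmul_eq_mul, mul_div_cancel_left₀ _ hm]

theorem integral_empMass {n : ℕ} (hn : 2 ≤ n) {θ' θ : Param Q d₀ d₁} (hθ' : θ' ∈ M.fullParams Q)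
    (hθ : θ ∈ M.fullParams Q) (δ : Bool) (t : ℝ) :
    ∫ ω : Sample n Q, M.empMass δ θ t ω ∂(M.law n θ') = M.mass δ θ' θ t := by
  have h := fun q l => M.integral_freq hn hθ' δ q l (M.measurableSet_ell_le hθ q l t)
  unfold empMass mass
  rw [integral_finsetSum _ fun q _ => integrable_finsetSum _ fun l _ => (h q l).1]
  refine Finset.sum_congr rfl fun q _ => ?_
  rw [integral_finsetSum _ fun l _ => (h q l).1]
  exact Finset.sum_congr rfl fun l _ => (h q l).2

/-- The event does not depend on `θ` or `t`, so data-dependent values may be inserted afterwards. -/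
theorem tendsto_empMass_uniform {Θ : Set (Param Q d₀ d₁)} {K : ℕ} (hcomp : M.Complexity Θ K)
    {θ₀ : Param Q d₀ d₁} (hθ₀ : θ₀ ∈ M.fullParams Q) {η : ℝ} (hη : 0 < η) :
    ∃ G : ∀ n, Set (Sample n Q), Tendsto (fun n => M.law n θ₀ (G n)ᶜ) atTop (𝓝 0) ∧
      ∀ n, ∀ ω ∈ G n, ∀ δ, ∀ θ ∈ Θ, ∀ t ∈ Icc (0 : ℝ) 1,
        |M.empMass δ θ t ω - M.mass δ θ₀ θ t| ≤ η := by
  obtain ⟨G, hG, hGω⟩ := M.tendsto_freq_uniform hθ₀ K (η := η / (Q * Q + 1)) (by positivity)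
  refine ⟨G, hG, fun n ω hω δ θ hθ t ht => ?_⟩
  unfold empMass mass
  simp_rw [← Finset.sum_sub_distrib]
  calc _ ≤ ∑ q : Fin Q, ∑ l : Fin Q, η / (Q * Q + 1) := by
        refine (Finset.abs_sum_le_sum_abs _ _).trans (Finset.sum_le_sum fun q _ => ?_)
        refine (Finset.abs_sum_le_sum_abs _ _).trans (Finset.sum_le_sum fun l _ => ?_)
        exact hGω n ω hω δ q l _ (hcomp q l t ht θ hθ)
    _ = Q * Q * (η / (Q * Q + 1)) := by simp [mul_assoc]
    _ ≤ η := by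
        rw [← mul_div_assoc, div_le_iff₀ (by positivity)]
        nlinarith

variable {Θ : Set (Param Q d₀ d₁)} {t₁ t₂ : Fin Q → Fin Q → Param Q d₀ d₁ → ℝ}

theorem qProc_eq_of_threshold {n : ℕ} {θ : Param Q d₀ d₁} (hθ : θ ∈ M.fullParams Q) {α τ : ℝ}
    (hτα : ∀ t ∈ Icc (0 : ℝ) 1, M.qVal θ θ t ≤ α ↔ t ≤ τ) (z : Fin n → Fin Q) (x : Edge n → ℝ)
    (e : Edge n) : M.qProc α θ z x e = decide (M.ell (x e) (z e.1.1) (z e.1.2) θ ≤ τ) := by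
  unfold qProc
  exact decide_eq_decide.2 (hτα _ (M.ell_mem_Icc hθ _ _ _))

/-- The false discovery proportion of a thresholding procedure is determined by the frequencies
of the false and of the true discoveries. -/
theorem fdp_le {n : ℕ} (θ : Param Q d₀ d₁) (τ : ℝ) (ω : Sample n Q) {β : ℝ}
    (hβ : 0 ≤ β)
    (h : M.empMass false θ τ ω ≤ β * (M.empMass false θ τ ω + M.empMass true θ τ ω)) :
    (∑ e, (1 - toReal (ω.2.1 e)) *
      toReal (decide (M.ell (ω.2.2 e) (ω.1 e.1.1) (ω.1 e.1.2) θ ≤ τ))) /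
      max (∑ e, toReal (decide (M.ell (ω.2.2 e) (ω.1 e.1.1) (ω.1 e.1.2) θ ≤ τ))) 1 ≤ β := by
  have h0 := M.card_mul_empMass false θ τ ω
  have h1 := M.card_mul_empMass true θ τ ω
  have e0 : ∀ b, toReal (b == false) = 1 - toReal b := by intro b; cases b <;> simp [toReal]
  have e1 : ∀ b, toReal (b == true) = toReal b := by intro b; cases b <;> simp [toReal]
  simp only [e0] at h0
  simp only [e1] at h1
  have h2 : ∑ e, toReal (decide (M.ell (ω.2.2 e) (ω.1 e.1.1) (ω.1 e.1.2) θ ≤ τ)) =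
      Fintype.card (Edge n) * (M.empMass false θ τ ω + M.empMass true θ τ ω) := by
    rw [mul_add, h0, h1, ← Finset.sum_add_distrib]
    exact Finset.sum_congr rfl fun e _ => by ring
  rw [← h0, h2, div_le_iff₀ (lt_max_of_lt_right one_pos)]
  calc _ ≤ (Fintype.card (Edge n) : ℝ) *
        (β * (M.empMass false θ τ ω + M.empMass true θ τ ω)) := by gcongr
    _ = β * (Fintype.card (Edge n) * (M.empMass false θ τ ω + M.empMass true θ τ ω)) := by ring
    _ ≤ _ := by gcongr; exact le_max_left _ _

/-- With probability tending to one, the plug-in procedure has false discovery proportion at most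
`α + ρ` and almost as many true discoveries as the oracle. -/
theorem exists_good_event {K : ℕ} (hΘ : Θ ⊆ M.fullParams Q)
    (hperm : ∀ θ ∈ Θ, ∀ σ : Equiv.Perm (Fin Q), θ.perm σ ∈ Θ)
    (hreg : M.Regularity Θ t₁ t₂) (hcomp : M.Complexity Θ K)
    {θ₀ : Param Q d₀ d₁} (hθ₀ : θ₀ ∈ Θ) {α : ℝ} (hα : M.alphaStar t₁ θ₀ < α)
    {θhat : ∀ n : ℕ, (Edge n → ℝ) → Param Q d₀ d₁} (hθhat : ∀ n x, θhat n x ∈ Θ)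
    {Zhat : ∀ n : ℕ, (Edge n → ℝ) → Fin n → Fin Q} (hcons : M.Consistent θ₀ θhat Zhat)
    {τ₀ : ℝ} (hτ₀ : τ₀ ∈ Icc (0 : ℝ) 1)
    (hτ₀α : ∀ t ∈ Icc (0 : ℝ) 1, M.qVal θ₀ θ₀ t ≤ α ↔ t ≤ τ₀) {ρ : ℝ} (hρ : 0 < ρ) :
    ∃ H : ∀ n, Set (Sample n Q), Tendsto (fun n => M.law n θ₀ (H n)ᶜ) atTop (𝓝 0) ∧
      ∀ n, ∀ ω ∈ H n,
        (∑ e, (1 - toReal (ω.2.1 e)) * toReal (M.plugInProc α (θhat n) (Zhat n) ω.2.2 e)) /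
          max (∑ e, toReal (M.plugInProc α (θhat n) (Zhat n) ω.2.2 e)) 1 ≤ α + ρ ∧
        Fintype.card (Edge n) * (M.mass true θ₀ θ₀ τ₀ - ρ) ≤
          ∑ e, toReal (ω.2.1 e) * toReal (M.plugInProc α (θhat n) (Zhat n) ω.2.2 e) := by
  have hα0 : 0 < α := (M.exists_qVal_lt hΘ hreg hθ₀ hα).1
  obtain ⟨s, hs, hsα, hspos, hsT⟩ := M.exists_level hΘ hreg hθ₀ hα hτ₀ hτ₀α (half_pos hρ)
  set N := M.mass false θ₀ θ₀ s with hN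
  set D := M.mass false θ₀ θ₀ s + M.mass true θ₀ θ₀ s with hD
  have hgap : 0 < α * D - N := by
    rw [qVal_eq_mass, div_lt_iff₀ hspos] at hsα
    linarith
  -- The four constraints serve, in order: the power loss, a lower bound `D / 2` on the selected
  -- frequency, the q-value at `s` staying below `α` after perturbation, and the absorption of all
  -- errors into `ρ`.
  obtain ⟨η, hη, hη1, hη2, hη3, hη4⟩ : ∃ η > 0, 4 * η ≤ ρ ∧ 8 * η ≤ D ∧
      (1 + 2 * α) * η ≤ α * D - N ∧ (6 * α + 3) * η ≤ ρ * (D / 2) := by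
    have hx : ∀ a : ℝ, 0 < a → ∀ b : ℝ, ∀ η ≤ b / a, a * η ≤ b := fun a ha b η h => by
      rwa [le_div_iff₀' ha] at h
    refine ⟨min (min (ρ / 4) (D / 8)) (min ((α * D - N) / (1 + 2 * α))
      (ρ * (D / 2) / (6 * α + 3))), lt_min (lt_min (by positivity) (by positivity))
        (lt_min (div_pos hgap (by positivity)) (by positivity)),
      hx _ (by norm_num) _ _ ?_, hx _ (by norm_num) _ _ ?_, hx _ (by positivity) _ _ ?_,
      hx _ (by positivity) _ _ ?_⟩
    · exact (min_le_left _ _).trans (min_le_left _ _)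
    · exact (min_le_left _ _).trans (min_le_right _ _)
    · exact (min_le_right _ _).trans (min_le_left _ _)
    · exact (min_le_right _ _).trans (min_le_right _ _)
  obtain ⟨ε, hε, hclose⟩ := M.exists_mass_close hreg hθ₀ hη
  obtain ⟨G, hG, hGω⟩ := M.tendsto_empMass_uniform hcomp (hΘ hθ₀) hη
  -- Halving makes the non-strict bound on the complement of the bad event strict; the cap below 1
  -- makes the memberships agree.
  set ε' := min (ε / 2) (1 / 2) with hε'
  have hε'0 : 0 < ε' := lt_min (half_pos hε) (by norm_num)
  refine ⟨fun n => G n ∩ {ω | ε' < labelDist (θhat n ω.2.2) (Zhat n ω.2.2) θ₀ ω.1}ᶜ, ?_, ?_⟩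
  · have hsum := hG.add (hcons ε' hε'0)
    rw [add_zero] at hsum
    refine tendsto_of_tendsto_of_tendsto_of_le_of_le tendsto_const_nhds hsum
      (fun _ => zero_le) fun n => ?_
    dsimp only
    rw [compl_inter, compl_compl]
    exact measure_union_le _ _
  rintro n ω ⟨hωG, hωL⟩
  simp only [mem_compl_iff, mem_ofPred_eq, not_lt] at hωL
  obtain ⟨σ, hσ, hZ⟩ := exists_perm_of_labelDist_lt (ε := min ε 1) (min_le_right _ _)
    (hωL.trans_lt (lt_min ((min_le_left _ _).trans_lt (half_lt_self hε))
      ((min_le_right _ _).trans_lt (by norm_num))))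
  set θ := (θhat n ω.2.2).perm σ with hθdef
  have hθ : θ ∈ Θ := hperm _ (hθhat n _) σ
  obtain ⟨τ, hτ, hτα⟩ := M.exists_threshold hΘ hreg hθ hα0.le
  have hproc : ∀ e, M.plugInProc α (θhat n) (Zhat n) ω.2.2 e =
      decide (M.ell (ω.2.2 e) (ω.1 e.1.1) (ω.1 e.1.2) θ ≤ τ) := by
    intro e
    rw [plugInProc, hZ, qProc_perm]
    exact M.qProc_eq_of_threshold (hΘ hθ) hτα _ _ e
  simp only [hproc]
  have hcl := hclose θ hθ (hσ.trans_le (min_le_left _ _))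
  -- The strict gap at `θ₀` absorbs an error `η` in the numerator and `2 η` in the denominator.
  have hsτ : s ≤ τ := by
    refine (hτα s hs).1 ?_
    have h0 := abs_le.1 (hcl false s hs).2
    have h1 := abs_le.1 (hcl true s hs).2
    rw [qVal_eq_mass, div_le_iff₀ (by linarith)]
    nlinarith
  have hN0 := abs_le.1 (hcl false τ hτ).1
  have hN1 := abs_le.1 (hcl false τ hτ).2
  have hT0 := abs_le.1 (hcl true τ hτ).1
  have hT1 := abs_le.1 (hcl true τ hτ).2
  have hEf := abs_le.1 (hGω n ω hωG false θ hθ τ hτ)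
  have hEt := abs_le.1 (hGω n ω hωG true θ hθ τ hτ)
  have hmf := M.monotone_mass (hΘ hθ₀) false θ₀ hsτ
  have hmt := M.monotone_mass (hΘ hθ₀) true θ₀ hsτ
  refine ⟨M.fdp_le θ τ ω (by positivity) ?_, ?_⟩
  · have hle : M.mass false θ θ τ ≤ α * (M.mass false θ θ τ + M.mass true θ θ τ) := by
      have h := (hτα τ hτ).2 le_rfl
      rwa [qVal_eq_mass, div_le_iff₀ (by linarith)] at h
    -- Passing from `mass δ θ θ τ` through `mass δ θ₀ θ₀ τ` and `mass δ θ₀ θ τ` to the frequency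
    -- costs `η` three times, hence `3 η` for the numerator and `6 η` for the total.
    set a := M.empMass false θ τ ω
    set b := M.empMass true θ τ ω
    have hab : D / 2 ≤ a + b := by linarith
    have h1 : α * (M.mass false θ θ τ + M.mass true θ θ τ) ≤ α * (a + b + 6 * η) :=
      mul_le_mul_of_nonneg_left (by linarith) hα0.le
    have h2 : ρ * (D / 2) ≤ ρ * (a + b) := mul_le_mul_of_nonneg_left hab hρ.le
    nlinarith
  · have h1 := M.card_mul_empMass true θ τ ω
    have e1 : ∀ b, toReal (b == true) = toReal b := by intro b; cases b <;> simp [toReal]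
    simp only [e1] at h1
    rw [← h1]
    refine mul_le_mul_of_nonneg_left ?_ (by positivity)
    linarith

end NoiseFamily

/-! ### From the good event to FDR and TDR -/

namespace NoiseFamily

variable {d₀ d₁ : ℕ} (M : NoiseFamily d₀ d₁) {Q : ℕ}

theorem mass_true_le_one {θ' : Param Q d₀ d₁} (hθ' : θ' ∈ M.fullParams Q) (θ : Param Q d₀ d₁)
    (t : ℝ) : M.mass true θ' θ t ≤ 1 := by
  have h : ∀ q l, M.cellProb θ' true q l {x | M.ell x q l θ ≤ t} ≤ θ'.prop q * θ'.prop l := by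
    intro q l
    have hP := M.isProbabilityMeasure_obsLaw hθ' true q l
    exact mul_le_of_le_one_right (mul_nonneg (hθ'.1 q).le (hθ'.1 l).le)
      (mul_le_one₀ (M.edgeWeight_le_one hθ' true q l) measureReal_nonneg measureReal_le_one)
  calc _ ≤ ∑ q, ∑ l, θ'.prop q * θ'.prop l :=
        Finset.sum_le_sum fun q _ => Finset.sum_le_sum fun l _ => h q l
    _ = 1 := by
      rw [← Finset.sum_mul_sum, hθ'.2.1, one_mul]

theorem mass_true_one_pos {θ : Param Q d₀ d₁} (hθ : θ ∈ M.fullParams Q) :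
    0 < M.mass true θ θ 1 := by
  have hne : Nonempty (Fin Q) := by
    by_contra hne
    rw [not_nonempty_iff] at hne
    have := hθ.2.1
    simp at this
  have h : ∀ q l, 0 < M.cellProb θ true q l {x | M.ell x q l θ ≤ 1} := by
    intro q l
    have hP := M.isProbabilityMeasure_obsLaw hθ true q l
    rw [show {x | M.ell x q l θ ≤ 1} = univ from
      eq_univ_of_forall fun x => (M.ell_mem_Icc hθ q l x).2, cellProb, probReal_univ, mul_one]
    exact mul_pos (mul_pos (hθ.1 q) (hθ.1 l)) (by simpa [Param.edgeWeight] using (hθ.2.2.1 q l).1)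
  exact Finset.sum_pos (fun q _ => Finset.sum_pos (fun l _ => h q l) Finset.univ_nonempty)
    Finset.univ_nonempty

/-- An `ℓ`-value never exceeds 1, so the threshold 1 selects every edge. -/
theorem integral_sum_edges {n : ℕ} (hn : 2 ≤ n) {θ : Param Q d₀ d₁} (hθ : θ ∈ M.fullParams Q) :
    ∫ ω : Sample n Q, ∑ e, toReal (ω.2.1 e) ∂(M.law n θ) =
      Fintype.card (Edge n) * M.mass true θ θ 1 := by
  rw [← M.integral_empMass hn hθ hθ, ← integral_const_mul]
  congr 1
  ext ω
  rw [card_mul_empMass]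
  refine Finset.sum_congr rfl fun e _ => ?_
  rw [decide_eq_true (M.ell_mem_Icc hθ _ _ _).2]
  simp [toReal]

theorem integral_oracle {n : ℕ} (hn : 2 ≤ n) {θ : Param Q d₀ d₁} (hθ : θ ∈ M.fullParams Q)
    {α τ : ℝ} (hτα : ∀ t ∈ Icc (0 : ℝ) 1, M.qVal θ θ t ≤ α ↔ t ≤ τ) :
    ∫ ω : Sample n Q, ∑ e, toReal (ω.2.1 e) * toReal (M.oracleProc α θ ω e) ∂(M.law n θ) =
      Fintype.card (Edge n) * M.mass true θ θ τ := by
  rw [← M.integral_empMass hn hθ hθ, ← integral_const_mul]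
  congr 1
  ext ω
  rw [card_mul_empMass]
  refine Finset.sum_congr rfl fun e _ => ?_
  rw [oracleProc, M.qProc_eq_of_threshold hθ hτα]
  simp

theorem integrable_sum_mul {n : ℕ} {θ : Param Q d₀ d₁} (hθ : θ ∈ M.fullParams Q)
    {φ : (Edge n → ℝ) → Edge n → Bool} (hφ : Measurable φ) :
    Integrable (fun ω : Sample n Q => ∑ e, toReal (ω.2.1 e) * toReal (φ ω.2.2 e)) (M.law n θ) := by
  have hL := M.isProbabilityMeasure_law n hθ
  refine integrable_finsetSum _ fun e _ => Integrable.of_bound (C := 1) ?_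
    (Eventually.of_forall fun ω => ?_)
  · have h1 : Measurable fun ω : Sample n Q => toReal (ω.2.1 e) :=
      measurable_toReal.comp (by fun_prop)
    have h2 : Measurable fun ω : Sample n Q => toReal (φ ω.2.2 e) :=
      measurable_toReal.comp ((measurable_pi_apply e).comp
        (hφ.comp (measurable_snd.comp measurable_snd)))
    exact (h1.mul h2).aestronglyMeasurable
  · rw [Real.norm_of_nonneg (mul_nonneg (toReal_nonneg _) (toReal_nonneg _))]
    exact mul_le_one₀ (toReal_le_one _) (toReal_nonneg _) (toReal_le_one _)

theorem fdp_mem_Icc {n : ℕ} (a φ : Edge n → Bool) :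
    (∑ e, (1 - toReal (a e)) * toReal (φ e)) / max (∑ e, toReal (φ e)) 1 ∈ Icc (0 : ℝ) 1 := by
  have h : ∀ e, 0 ≤ 1 - toReal (a e) := fun e => sub_nonneg.2 (toReal_le_one _)
  refine ⟨div_nonneg (Finset.sum_nonneg fun e _ => mul_nonneg (h e) (toReal_nonneg _))
    (le_max_of_le_right zero_le_one), div_le_one_of_le₀ ?_ (le_max_of_le_right zero_le_one)⟩
  refine le_max_of_le_left (Finset.sum_le_sum fun e _ => ?_)
  exact mul_le_of_le_one_left (toReal_nonneg _) (by linarith [toReal_nonneg (a e)])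

theorem integrable_fdp {n : ℕ} {θ : Param Q d₀ d₁} (hθ : θ ∈ M.fullParams Q)
    {φ : (Edge n → ℝ) → Edge n → Bool} (hφ : Measurable φ) :
    Integrable (fun ω : Sample n Q => (∑ e, (1 - toReal (ω.2.1 e)) * toReal (φ ω.2.2 e)) /
      max (∑ e, toReal (φ ω.2.2 e)) 1) (M.law n θ) := by
  have hL := M.isProbabilityMeasure_law n hθ
  have h1 : ∀ e, Measurable fun ω : Sample n Q => toReal (ω.2.1 e) :=
    fun e => measurable_toReal.comp (by fun_prop)
  have h2 : ∀ e, Measurable fun ω : Sample n Q => toReal (φ ω.2.2 e) :=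
    fun e => measurable_toReal.comp ((measurable_pi_apply e).comp
        (hφ.comp (measurable_snd.comp measurable_snd)))
  refine Integrable.of_bound (C := 1) ?_ (Eventually.of_forall fun ω => ?_)
  · exact (Measurable.div (by fun_prop) (by fun_prop)).aestronglyMeasurable
  · have := fdp_mem_Icc ω.2.1 (φ ω.2.2)
    rw [Real.norm_of_nonneg this.1]
    exact this.2

variable {Θ : Set (Param Q d₀ d₁)} {t₁ t₂ : Fin Q → Fin Q → Param Q d₀ d₁ → ℝ}
  {K : ℕ} {θ₀ : Param Q d₀ d₁} {α : ℝ} {θhat : ∀ n : ℕ, (Edge n → ℝ) → Param Q d₀ d₁}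
  {Zhat : ∀ n : ℕ, (Edge n → ℝ) → Fin n → Fin Q}

theorem limsup_FDR_le
    (hθ₀ : θ₀ ∈ M.fullParams Q) (hα : 0 ≤ α)
    (hmeas : ∀ n, Measurable (M.plugInProc α (θhat n) (Zhat n)))
    (h : ∀ ρ > 0, ∃ H : ∀ n, Set (Sample n Q), Tendsto (fun n => M.law n θ₀ (H n)ᶜ) atTop (𝓝 0) ∧
      ∀ n, ∀ ω ∈ H n,
        (∑ e, (1 - toReal (ω.2.1 e)) * toReal (M.plugInProc α (θhat n) (Zhat n) ω.2.2 e)) /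
          max (∑ e, toReal (M.plugInProc α (θhat n) (Zhat n) ω.2.2 e)) 1 ≤ α + ρ) :
    limsup (fun n => M.FDR n θ₀ fun ω => M.plugInProc α (θhat n) (Zhat n) ω.2.2) atTop ≤ α := by
  refine le_of_forall_pos_le_add fun ρ hρ => ?_
  obtain ⟨H, hH, hHω⟩ := h (ρ / 2) (half_pos hρ)
  refine limsup_le_of_le (isCoboundedUnder_le_of_le atTop (x := 0) fun n =>
    integral_nonneg fun ω => (fdp_mem_Icc ω.2.1 _).1) ?_
  have hH' := (ENNReal.tendsto_toReal ENNReal.zero_ne_top).comp hH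
  filter_upwards [hH'.eventually_lt_const (show (0 : ENNReal).toReal < ρ / 2 by simpa using hρ)]
    with n hn
  have hL := M.isProbabilityMeasure_law n hθ₀
  refine (integral_le_add_measureReal_compl _ (M.integrable_fdp hθ₀ (hmeas n)) (hHω n)
    fun ω => (fdp_mem_Icc ω.2.1 _).2.trans (by linarith)).trans ?_
  have : (M.law n θ₀).real (H n)ᶜ < ρ / 2 := hn
  linarith

theorem zero_le_liminf_TDR_sub
    (hθ₀ : θ₀ ∈ M.fullParams Q) {τ₀ : ℝ}
    (hτ₀α : ∀ t ∈ Icc (0 : ℝ) 1, M.qVal θ₀ θ₀ t ≤ α ↔ t ≤ τ₀)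
    (hmeas : ∀ n, Measurable (M.plugInProc α (θhat n) (Zhat n)))
    (h : ∀ ρ > 0, ∃ H : ∀ n, Set (Sample n Q), Tendsto (fun n => M.law n θ₀ (H n)ᶜ) atTop (𝓝 0) ∧
      ∀ n, ∀ ω ∈ H n, Fintype.card (Edge n) * (M.mass true θ₀ θ₀ τ₀ - ρ) ≤
          ∑ e, toReal (ω.2.1 e) * toReal (M.plugInProc α (θhat n) (Zhat n) ω.2.2 e)) :
    0 ≤ liminf (fun n => M.TDR n θ₀ (fun ω => M.plugInProc α (θhat n) (Zhat n) ω.2.2) -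
          M.TDR n θ₀ (M.oracleProc α θ₀)) atTop := by
  have hW := M.mass_true_one_pos hθ₀
  set W := M.mass true θ₀ θ₀ 1 with hWdef
  have hle : ∀ n, ∀ ω : Sample n Q,
      ∑ e, toReal (ω.2.1 e) * toReal (M.plugInProc α (θhat n) (Zhat n) ω.2.2 e) ≤
        ∑ e, toReal (ω.2.1 e) := fun n ω =>
    Finset.sum_le_sum fun e _ => mul_le_of_le_one_right (toReal_nonneg _) (toReal_le_one _)
  have hbdd : ∀ n, M.TDR n θ₀ (fun ω => M.plugInProc α (θhat n) (Zhat n) ω.2.2) -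
      M.TDR n θ₀ (M.oracleProc α θ₀) ≤ 1 := by
    intro n
    have hL := M.isProbabilityMeasure_law n hθ₀
    have hden : 0 ≤ ∫ ω : Sample n Q, ∑ e, toReal (ω.2.1 e) ∂(M.law n θ₀) :=
      integral_nonneg fun ω => Finset.sum_nonneg fun e _ => toReal_nonneg _
    have h1 : M.TDR n θ₀ (fun ω => M.plugInProc α (θhat n) (Zhat n) ω.2.2) ≤ 1 := by
      refine div_le_one_of_le₀ ?_ hden
      refine integral_mono (M.integrable_sum_mul hθ₀ (hmeas n)) ?_ (hle n)
      -- The number of edges is the number of true discoveries of the procedure that always rejects.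
      simpa [toReal] using M.integrable_sum_mul (n := n) hθ₀ (φ := fun _ _ => true) measurable_const
    have h2 : 0 ≤ M.TDR n θ₀ (M.oracleProc α θ₀) :=
      div_nonneg (integral_nonneg fun ω => Finset.sum_nonneg fun e _ =>
        mul_nonneg (toReal_nonneg _) (toReal_nonneg _)) hden
    linarith
  refine le_of_forall_pos_sub_le fun κ hκ => ?_
  rw [zero_sub]
  refine le_liminf_of_le (isCoboundedUnder_ge_of_le atTop (x := 1) hbdd) ?_
  -- One `ρ` is lost on the good event and one through its complement; dividing `2 ρ` by the edge
  -- density `W` gives `κ`.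
  set ρ := κ * W / 2 with hρdef
  have hρ : 0 < ρ := by positivity
  obtain ⟨H, hH, hHω⟩ := h ρ hρ
  have hH' := (ENNReal.tendsto_toReal ENNReal.zero_ne_top).comp hH
  filter_upwards [hH'.eventually_lt_const (show (0 : ENNReal).toReal < ρ by simpa using hρ),
    eventually_ge_atTop 2] with n hn hn2
  have hn' : (M.law n θ₀).real (H n)ᶜ < ρ := hn
  have hL := M.isProbabilityMeasure_law n hθ₀
  have hm : (0 : ℝ) < Fintype.card (Edge n) := by
    have : Nonempty (Edge n) := ⟨⟨(⟨0, by omega⟩, ⟨1, by omega⟩), by simp⟩⟩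
    exact_mod_cast Fintype.card_pos
  set m : ℝ := (Fintype.card (Edge n) : ℝ) with hmdef
  have hI := M.integrable_sum_mul hθ₀ (hmeas n)
  -- The upper bound is applied to minus the proportion of true discoveries; its global condition
  -- holds because the mass is at most 1.
  have hlow := integral_le_add_measureReal_compl (M.law n θ₀) (hI.div_const m).neg
    (c := ρ - M.mass true θ₀ θ₀ τ₀) (H := H n)
    (fun ω hω => by
      have := hHω n ω hω
      rw [← le_div_iff₀' hm] at this
      simp only [Pi.neg_apply]
      linarith)
    (fun ω => by
      have h1 : (0 : ℝ) ≤ (∑ e, toReal (ω.2.1 e) *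
          toReal (M.plugInProc α (θhat n) (Zhat n) ω.2.2 e)) / m :=
        div_nonneg (Finset.sum_nonneg fun e _ =>
          mul_nonneg (toReal_nonneg _) (toReal_nonneg _)) hm.le
      have h2 := M.mass_true_le_one hθ₀ θ₀ τ₀
      simp only [Pi.neg_apply]
      linarith)
  simp only [Pi.neg_apply] at hlow
  rw [integral_neg, integral_div] at hlow
  rw [TDR, TDR, M.integral_oracle hn2 hθ₀ hτ₀α, M.integral_sum_edges hn2 hθ₀, ← hmdef, ← hWdef,
    ← sub_div, le_div_iff₀ (by positivity)]
  have h3 : M.mass true θ₀ θ₀ τ₀ - 2 * ρ ≤ (∫ ω : Sample n Q, ∑ e, toReal (ω.2.1 e) *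
      toReal (M.plugInProc α (θhat n) (Zhat n) ω.2.2 e) ∂(M.law n θ₀)) / m := by linarith
  rw [le_div_iff₀ hm] at h3
  have h4 : -κ * (m * W) = -(2 * ρ) * m := by rw [hρdef]; ring
  rw [h4]
  linarith

end NoiseFamily
end NSBM

end

theorem corollary1 {Q d₀ d₁ K : ℕ} (M : NSBM.NoiseFamily d₀ d₁)
    (Θ : Set (NSBM.Param Q d₀ d₁)) (hΘ : Θ ⊆ M.fullParams Q)
    (hperm : ∀ θ ∈ Θ, ∀ σ : Equiv.Perm (Fin Q), θ.perm σ ∈ Θ)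
    (t₁ t₂ : Fin Q → Fin Q → NSBM.Param Q d₀ d₁ → ℝ)
    (hreg : M.Regularity Θ t₁ t₂) (hK : 0 < K) (hcomp : M.Complexity Θ K)
    (θ₀ : NSBM.Param Q d₀ d₁) (hθ₀ : θ₀ ∈ Θ)
    (α : ℝ) (hα : α ∈ Set.Ioo (M.alphaStar t₁ θ₀) θ₀.nullProp)
    (θhat : ∀ n : ℕ, (NSBM.Edge n → ℝ) → NSBM.Param Q d₀ d₁)
    (hθhat : ∀ n x, θhat n x ∈ Θ)
    (Zhat : ∀ n : ℕ, (NSBM.Edge n → ℝ) → Fin n → Fin Q)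
    (hmeas : ∀ n, Measurable (M.plugInProc α (θhat n) (Zhat n)))
    (hcons : M.Consistent θ₀ θhat Zhat) :
    Filter.limsup
        (fun n => M.FDR n θ₀ fun ω => M.plugInProc α (θhat n) (Zhat n) ω.2.2)
        Filter.atTop ≤ α ∧
      0 ≤ Filter.liminf
        (fun n => M.TDR n θ₀ (fun ω => M.plugInProc α (θhat n) (Zhat n) ω.2.2) -
          M.TDR n θ₀ (M.oracleProc α θ₀))
        Filter.atTop := by
  have hα0 := (M.exists_qVal_lt hΘ hreg hθ₀ hα.1).1
  obtain ⟨τ₀, hτ₀, hτ₀α⟩ := M.exists_threshold hΘ hreg hθ₀ hα0.le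
  have hgood := fun ρ (hρ : 0 < ρ) => M.exists_good_event hΘ hperm hreg hcomp hθ₀ hα.1 hθhat
    hcons hτ₀ hτ₀α hρ
  refine ⟨M.limsup_FDR_le (hΘ hθ₀) hα0.le hmeas fun ρ hρ => ?_,
    M.zero_le_liminf_TDR_sub (hΘ hθ₀) hτ₀α hmeas fun ρ hρ => ?_⟩
  · obtain ⟨H, hH, hHω⟩ := hgood ρ hρ
    exact ⟨H, hH, fun n ω hω => (hHω n ω hω).1⟩
  · obtain ⟨H, hH, hHω⟩ := hgood ρ hρ
    exact ⟨H, hH, fun n ω hω => (hHω n ω hω).2⟩
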